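/- **Conventions.** Fix integers $l,k\ge 0$. All products of Euclidean spaces carry the Euclidean norm. For $A\subset\mathbb R^s$ and $x\in A$ let $T_A(x)=\{w : \exists\, t_i\downarrow 0,\ w_i\to w,\ x+t_iw_i\in A\ \forall i\}$ (tangent cone), $\widehat N_A(x)=\{x^* : \langle x^*,w\rangle\le 0\ \forall w\in T_A(x)\}$ (regular normal cone), and $T^\sharp_A(x)=\{w : \exists\, x_i\to x,\ x_i\in A,\ w_i\in T_A(x_i),\ w_i\to w\}$ (outer limiting tangent cone). The set $A$ is semismooth$^{*}$ at $x$ if for every $\epsilon>0$ there is $\delta>0$ with $|\langle x^*,x'-x\rangle|\le\epsilon\|x'-x\|\,\|x^*\|$ for all $x'\in A$ with $\|x'-x\|\le\delta$ and all $x^*\in\widehat N_A(x')$. For $F:\mathbb R^n\rightrightarrows\mathbb R^m$ let $\mathrm{gph}\,F=\{(x,y): y\in F(x)\}$ and let $\mathcal O_F$ be the set of $(x,y)\in\mathrm{gph}\,F$ for which $T_{\mathrm{gph}\,F}(x,y)$ is an $n$-dimensional linear subspace of $\mathbb R^{n+m}$; let $\mathrm{gph}\,\widehat D^*F(x,y)=\{(y^*,x^*)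 : (x^*,-y^*)\in\widehat N_{\mathrm{gph}\,F}(x,y)\}$. Subspaces converge, $L_i\to L$, if the orthogonal projections onto $L_i$ converge in norm to the one onto $L$. $\mathcal SF(x,y)$ is the set of $n$-dimensional subspaces $L$ of $\mathbb R^n\times\mathbb R^m$ such that $T_{\mathrm{gph}\,F}(x_i,y_i)\to L$ for some sequence $(x_i,y_i)\to(x,y)$ in $\mathcal O_F$; $\mathcal S^*F(x,y)$ is the set of $m$-dimensional subspaces $L^*$ of $\mathbb R^m\times\mathbb R^n$ such that $\mathrm{gph}\,\widehat D^*F(x_i,y_i)\to L^*$ for some such sequence. $F$ has the *SCD property* at $(x,y)\in\mathrm{gph}\,F$ if $\mathcal S^*F(x,y)\neq\emptyset$, and is semismooth$^{*}$ at $(x,y)$ if $\mathrm{gph}\,F$ is. A property holds *around* $(x,y)$ if it holds at every point of $\mathrm{gph}\,F$ in some neighborhood of $(x,y)$. For a convex set $C$, $N_C(d)=\{d^*:\langle d^*,z-d\rangle\le0\ \forall z\in C\}$ if $d\in C$, and $N_C(d)=\emptyset$ otherwise. A face of a convex set $K$ is a nonempty convex $\mathcal F\subset K$ containing both end points of every segment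 in $K$ that has a relative interior point in $\mathcal F$. $S^\perp$ is the set of vectors orthogonal to all elements of $S$. For $d^*\in N_D(d)$ let $\mathcal K_D(d,d^*)=T_D(d)\cap\{d^*\}^\perp$. **Proposition 5.4.** Let $D\subset\mathbb R^k$ be a convex polyhedral set (a finite intersection of closed half-spaces), let $g:\mathbb R^l\times\mathbb R^k\to\mathbb R^k$ be continuously differentiable, let $g(\bar x,\bar y)\in D$, and suppose that the Jacobian $\nabla g(\bar x,\bar y)$ has full row rank $k$. Define $Q:\mathbb R^l\times\mathbb R^k\rightrightarrows\mathbb R^k$ by $Q(x,y)=N_D(g(x,y))$. Then for every $d^*\in N_D(g(\bar x,\bar y))$ the mapping $Q$ has the SCD property around $((\bar x,\bar y),d^*)$ and is semismooth$^{*}$ around $((\bar x,\bar y),d^*)$. Further, $$\mathcal SQ((\bar x,\bar y),d^*)=\Big\{\{((u,v),e^*) : \nabla g(\bar x,\bar y)(u,v)\in\mathcal F-\mathcal F,\ e^*\in(\mathcal F-\mathcal F)^\perp\}\ \Big|\ \mathcal F\text{ is a face of }\mathcal K_D(g(\bar x,\bar y),d^*)\Big\}$$ and $$T^\sharp_{\mathrm{gph}\,Q}((\bar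 x,\bar y),d^*)=\Big\{((u,v),e^*) : (\nabla g(\bar x,\bar y)(u,v),e^*)\in\mathrm{gph}\,N_{\mathcal F_1-\mathcal F_2}\text{ for some faces }\mathcal F_2\subset\mathcal F_1\text{ of }\mathcal K_D(g(\bar x,\bar y),d^*)\Big\}.$$ -/

import Mathlib

open Filter Topology

open scoped Pointwise

namespace VarAnal

/-! ### Cones attached to a set in a finite-dimensional Euclidean space -/

section Sets

variable {H : Type*} [NormedAddCommGroup H] [InnerProductSpace ℝ H]

/-- The tangent (contingent, Bouligand) cone `Lim sup_{t ↓ 0} (A - x) / t`. -/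
def tangentCone (A : Set H) (x : H) : Set H :=
  {w | ∃ (t : ℕ → ℝ) (v : ℕ → H), (∀ i, 0 < t i) ∧ Tendsto t atTop (𝓝 0) ∧
    Tendsto v atTop (𝓝 w) ∧ ∀ i, x + t i • v i ∈ A}

/-- The outer limiting tangent cone `Lim sup_{x' → x, x' ∈ A} T_A(x')`. -/
def outerLimitingTangentCone (A : Set H) (x : H) : Set H :=
  {w | ∃ (p : ℕ → H) (v : ℕ → H), (∀ i, p i ∈ A) ∧ Tendsto p atTop (𝓝 x) ∧
    (∀ i, v i ∈ tangentCone A (p i)) ∧ Tendsto v atTop (𝓝 w)}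

/-- The (negative) polar of a set. -/
def polar (K : Set H) : Set H :=
  {v | ∀ w ∈ K, inner ℝ v w ≤ 0}

/-- The vectors orthogonal to all elements of a set. -/
def orth (K : Set H) : Set H :=
  {v | ∀ w ∈ K, inner ℝ v w = 0}

/-- The regular (Fréchet) normal cone: the polar of the tangent cone. -/
def regularNormalCone (A : Set H) (x : H) : Set H :=
  polar (tangentCone A x)

/-- The normal cone of convex analysis; empty at points outside of `D`. -/
def normalCone (D : Set H) (x : H) : Set H :=
  {v | x ∈ D ∧ ∀ z ∈ D, inner ℝ v (z - x) ≤ 0}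

/-- A convex polyhedral set: a finite intersection of closed half-spaces. -/
def IsConvexPolyhedral (D : Set H) : Prop :=
  ∃ (N : ℕ) (a : Fin N → H) (b : Fin N → ℝ), D = {z | ∀ i, inner ℝ (a i) z ≤ b i}

/-- The critical cone `T_D(d) ∩ [d*]^⊥`. -/
def criticalCone (D : Set H) (d ds : H) : Set H :=
  tangentCone D d ∩ orth {ds}

/-- `F` is a (nonempty) face of the convex set `K`: a nonempty convex subset of `K` that contains
the end points of every segment in `K` having a relative interior point in `F`. -/
def IsFace (K F : Set H) : Prop :=
  F.Nonempty ∧ Convex ℝ F ∧ IsExtreme ℝ K F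

/-- The semismooth* property of a set at a point. -/
def SemismoothStarSetAt (A : Set H) (x : H) : Prop :=
  ∀ ε : ℝ, 0 < ε → ∃ δ : ℝ, 0 < δ ∧ ∀ x' ∈ A ∩ Metric.closedBall x δ,
    ∀ n ∈ regularNormalCone A x', |inner ℝ n (x' - x)| ≤ ε * ‖x' - x‖ * ‖n‖

/-- Convergence of subspaces in the metric `‖P₁ - P₂‖`, where `Pᵢ` are the orthogonal
projections. -/
def SubspaceTendsto [FiniteDimensional ℝ H] (L : ℕ → Submodule ℝ H) (L₀ : Submodule ℝ H) : Prop :=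
  Tendsto (fun i => ‖(L i).starProjection - L₀.starProjection‖) atTop (𝓝 0)

end Sets

/-! ### Set-valued mappings

Products carry the Euclidean norm, that is, they are `L²` products. -/

section Maps

variable {E G : Type*} [NormedAddCommGroup E] [InnerProductSpace ℝ E] [FiniteDimensional ℝ E]
  [NormedAddCommGroup G] [InnerProductSpace ℝ G] [FiniteDimensional ℝ G]

/-- The graph of a set-valued mapping. -/
def gph (F : E → Set G) : Set (WithLp 2 (E × G)) :=
  {z | z.snd ∈ F z.fst}

/-- The graph of the regular (Fréchet) coderivative of `F` at `z`: all `(y*, x*)` with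
`(x*, -y*)` in the regular normal cone to `gph F` at `z`. -/
def gphRegularCoderivative (F : E → Set G) (z : WithLp 2 (E × G)) : Set (WithLp 2 (G × E)) :=
  {q | WithLp.toLp 2 (q.snd, -q.fst) ∈ regularNormalCone (gph F) z}

/-- The set `O_F` of points of `gph F` at which `F` is graphically smooth of dimension `dim E`:
the tangent cone to the graph is a subspace of dimension `dim E`. -/
def graphicallySmoothPoints (F : E → Set G) : Set (WithLp 2 (E × G)) :=
  {z | z ∈ gph F ∧ ∃ L : Submodule ℝ (WithLp 2 (E × G)),
    Module.finrank ℝ L = Module.finrank ℝ E ∧ (L : Set (WithLp 2 (E × G))) = tangentCone (gph F) z}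

/-- The SC (subspace containing) limiting graphical derivative `𝒮F` at `z`. -/
def scDerivative (F : E → Set G) (z : WithLp 2 (E × G)) :
    Set (Submodule ℝ (WithLp 2 (E × G))) :=
  {L | Module.finrank ℝ L = Module.finrank ℝ E ∧
    ∃ (p : ℕ → WithLp 2 (E × G)) (M : ℕ → Submodule ℝ (WithLp 2 (E × G))),
      (∀ i, p i ∈ graphicallySmoothPoints F) ∧ Tendsto p atTop (𝓝 z) ∧
      (∀ i, (M i : Set (WithLp 2 (E × G))) = tangentCone (gph F) (p i)) ∧
      SubspaceTendsto M L}

/-- The SC (subspace containing) limiting coderivative `𝒮*F` at `z`. -/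
def scCoderivative (F : E → Set G) (z : WithLp 2 (E × G)) :
    Set (Submodule ℝ (WithLp 2 (G × E))) :=
  {L | Module.finrank ℝ L = Module.finrank ℝ G ∧
    ∃ (p : ℕ → WithLp 2 (E × G)) (M : ℕ → Submodule ℝ (WithLp 2 (G × E))),
      (∀ i, p i ∈ graphicallySmoothPoints F) ∧ Tendsto p atTop (𝓝 z) ∧
      (∀ i, (M i : Set (WithLp 2 (G × E))) = gphRegularCoderivative F (p i)) ∧
      SubspaceTendsto M L}

/-- The SCD property at a point of the graph. -/
def HasSCDPropertyAt (F : E → Set G) (z : WithLp 2 (E × G)) : Prop :=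
  (scCoderivative F z).Nonempty

/-- The SCD property around a point of the graph: the property holds at all points of the graph
in some neighborhood. -/
def HasSCDPropertyAround (F : E → Set G) (z : WithLp 2 (E × G)) : Prop :=
  ∃ W ∈ 𝓝 z, ∀ z' ∈ gph F ∩ W, HasSCDPropertyAt F z'

/-- The semismooth* property of a set-valued mapping at a point of its graph. -/
def SemismoothStarAt (F : E → Set G) (z : WithLp 2 (E × G)) : Prop :=
  SemismoothStarSetAt (gph F) z

/-- The semismooth* property around a point of the graph: the property holds at all points of the
graph in some neighborhood. -/
def SemismoothStarAround (F : E → Set G) (z : WithLp 2 (E × G)) : Prop :=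
  ∃ W ∈ 𝓝 z, ∀ z' ∈ gph F ∩ W, SemismoothStarAt F z'

end Maps

end VarAnal

/-! The graph of `Q` is the preimage of the graph of `N_D` under the map `(q, d*) ↦ (g q, d*)`, a
submersion near the reference point. Hence tangent cones to it at nearby points are preimages, under
the derivative there, of tangent cones to the graph of `N_D` (`mem_tangentCone_preimage_iff`).

Let `K` be the critical cone at the reference point. Near `(d, d*)` the graph of `N_D` is a
translate of the graph of `N_K` (`eventually_add_mem_gph_normalCone_iff`). Applying this again at a
point `(v, v*)` of the graph of `N_K` gives the tangent cone there: the graph of the normal cone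
mapping of the critical cone of `K` at `(v, v*)`. That cone equals `F₁ - F₂`, where `F₁ = K ∩ v*^⊥`
and `F₂` is the smallest face containing `v` (`criticalCone_eq_sub`). Conversely every nested pair
of faces arises in this way arbitrarily close to the origin (`exists_criticalCone_eq_sub`).

Since `K` has finitely many faces (`finite_faces`), only the derivative of `g` varies in the limit,
and it converges. This yields the formula for the outer limiting tangent cone. If the graph of
`N_{F₁ - F₂}` is a subspace, then so is `F₁ - F₂`, which forces it to be the span of `F₁`; this
yields the formula for `𝒮Q`. The SCD property follows because orthogonal complements and a rotation
carry elements of `𝒮Q` to elements of `𝒮*Q`.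

For semismoothness*, in a translated cone both directions `±(x' - x)` are tangent at `x'`, so
regular normals at `x'` are orthogonal to `x' - x`. Pulling back by a `C¹` submersion perturbs this
only by `o(‖x' - x‖)` (`semismoothStarSetAt_preimage`). -/

namespace VarAnal

/-! ### Finitely generated cones and the Minkowski–Weyl theorem. -/

section Generators

variable {H : Type*} [NormedAddCommGroup H] [InnerProductSpace ℝ H]

lemma mem_hull_finset_iff {T : Finset H} {x : H} :
    x ∈ PointedCone.hull ℝ (T : Set H) ↔ ∃ c : H → ℝ, (∀ t, 0 ≤ c t) ∧ x = ∑ t ∈ T, c t • t := by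
  constructor
  · intro hx
    obtain ⟨f, -, rfl⟩ := Submodule.mem_span_finset.1 hx
    exact ⟨fun t => (f t : ℝ), fun t => (f t).2, rfl⟩
  · rintro ⟨c, hc, rfl⟩
    exact sum_mem fun t ht =>
      PointedCone.smul_mem _ (hc t) (Submodule.subset_span (by exact_mod_cast ht))

/-- The cone cut out of a finitely generated cone by a half-space is finitely generated. -/
lemma exists_hull_inter_halfspace (T : Finset H) (a : H) :
    ∃ T' : Finset H, ∀ x, x ∈ PointedCone.hull ℝ (T' : Set H) ↔
      x ∈ PointedCone.hull ℝ (T : Set H) ∧ inner ℝ a x ≤ 0 := by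
  classical
  set P := T.filter fun t => 0 < inner ℝ a t with hP
  set Z := T.filter fun t => ¬ 0 < inner ℝ a t with hZ
  set M := Z.filter fun t => inner ℝ a t < 0 with hM
  -- Fourier–Motzkin elimination: keep the generators inside the half-space, and for each pair on
  -- strictly opposite sides add the positive combination that lies on the hyperplane.
  set T' : Finset H := Z ∪
    Finset.image₂ (fun p m => inner ℝ a p • m - inner ℝ a m • p) P M with hT'
  have hMT : ∀ m ∈ M, m ∈ T := fun m hm => (Finset.mem_filter.1 (Finset.mem_filter.1 hm).1).1
  have hPT : ∀ m ∈ P, m ∈ T := fun m hm => (Finset.mem_filter.1 hm).1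
  refine ⟨T', fun x => ⟨fun hx => ?_, ?_⟩⟩
  · refine Submodule.span_induction (p := fun x _ => x ∈ PointedCone.hull ℝ (T : Set H) ∧
      inner ℝ a x ≤ 0) ?_ ?_ ?_ ?_ hx
    · intro t ht
      rcases Finset.mem_union.1 (Finset.mem_coe.1 ht) with ht | ht
      · obtain ⟨h1, h2⟩ := Finset.mem_filter.1 ht
        exact ⟨Submodule.subset_span (by exact_mod_cast h1), not_lt.1 h2⟩
      · obtain ⟨p, hp, m, hm, rfl⟩ := Finset.mem_image₂.1 ht
        have hp0 := (Finset.mem_filter.1 hp).2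
        have hm0 := (Finset.mem_filter.1 hm).2
        constructor
        · rw [sub_eq_add_neg, ← neg_smul]
          exact add_mem (PointedCone.smul_mem _ hp0.le
              (Submodule.subset_span (by exact_mod_cast hMT m hm)))
            (PointedCone.smul_mem _ (by linarith)
              (Submodule.subset_span (by exact_mod_cast hPT p hp)))
        · rw [inner_sub_right, inner_smul_right, inner_smul_right]
          linarith [mul_comm (inner ℝ a p) (inner ℝ a m)]
    · simp
    · rintro x y - - ⟨hx, hx'⟩ ⟨hy, hy'⟩
      exact ⟨add_mem hx hy, by rw [inner_add_right]; linarith⟩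
    · rintro r x - ⟨hx, hx'⟩
      refine ⟨Submodule.smul_mem _ r hx, ?_⟩
      have : r • x = (r : ℝ) • x := rfl
      rw [this, inner_smul_right]
      exact mul_nonpos_of_nonneg_of_nonpos r.2 hx'
  · rintro ⟨hx, hax⟩
    obtain ⟨c, hc, rfl⟩ := mem_hull_finset_iff.1 hx
    set C := PointedCone.hull ℝ (T' : Set H)
    have hZC : ∀ t ∈ Z, t ∈ C := fun t ht =>
      Submodule.subset_span (by simp only [hT', Finset.coe_union]; exact Or.inl ht)
    have hPMC : ∀ p ∈ P, ∀ m ∈ M, inner ℝ a p • m - inner ℝ a m • p ∈ C := fun p hp m hm =>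
      Submodule.subset_span (by
        rw [hT', Finset.coe_union]
        exact Or.inr (Finset.mem_coe.2 (Finset.mem_image₂_of_mem hp hm)))
    set p := ∑ t ∈ P, c t * inner ℝ a t with hp
    set n := ∑ t ∈ M, c t * inner ℝ a t with hn
    set xp := ∑ t ∈ P, c t • t with hxp
    set xn := ∑ t ∈ M, c t • t with hxn
    set x0 := ∑ t ∈ Z with ¬ inner ℝ a t < 0, c t • t with hx0
    have hsum : ∑ t ∈ T, c t • t = xp + (xn + x0) := by
      rw [hxp, hxn, hx0, hM, Finset.sum_filter_add_sum_filter_not, hP, hZ,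
        Finset.sum_filter_add_sum_filter_not]
    have hp0 : 0 ≤ p := Finset.sum_nonneg fun t ht =>
      mul_nonneg (hc t) (Finset.mem_filter.1 ht).2.le
    have hn0 : n ≤ 0 := Finset.sum_nonpos fun t ht =>
      mul_nonpos_of_nonneg_of_nonpos (hc t) (Finset.mem_filter.1 ht).2.le
    have hx0a : inner ℝ a x0 = 0 := by
      rw [hx0, inner_sum]
      refine Finset.sum_eq_zero fun t ht => ?_
      obtain ⟨h1, h2⟩ := Finset.mem_filter.1 ht
      have h3 := (Finset.mem_filter.1 h1).2
      rw [inner_smul_right, le_antisymm (not_lt.1 h3) (not_lt.1 h2), mul_zero]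
    have hpn : p + n ≤ 0 := by
      rw [hsum, inner_add_right, inner_add_right, hx0a, hxp, hxn, inner_sum, inner_sum] at hax
      simpa only [inner_smul_right, add_zero] using hax
    have hxnC : xn ∈ C := sum_mem fun t ht =>
      PointedCone.smul_mem _ (hc t) (hZC t (Finset.mem_filter.1 ht).1)
    have hx0C : x0 ∈ C := sum_mem fun t ht =>
      PointedCone.smul_mem _ (hc t) (hZC t (Finset.mem_filter.1 ht).1)
    have hmix : p • xn - n • xp ∈ C := by
      have : p • xn - n • xp = ∑ i ∈ P, ∑ j ∈ M,
          (c i * c j) • (inner ℝ a i • j - inner ℝ a j • i) := by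
        simp only [smul_sub, Finset.sum_sub_distrib]
        congr 1
        · rw [hp, hxn, Finset.sum_smul_sum]
          exact Finset.sum_congr rfl fun i _ => Finset.sum_congr rfl fun j _ => by
            rw [smul_smul, smul_smul]; congr 1; ring
        · rw [hn, hxp, Finset.sum_smul_sum, Finset.sum_comm]
          exact Finset.sum_congr rfl fun i _ => Finset.sum_congr rfl fun j _ => by
            rw [smul_smul, smul_smul]; congr 1; ring
      rw [this]
      exact sum_mem fun i hi => sum_mem fun j hj =>
        PointedCone.smul_mem _ (mul_nonneg (hc i) (hc j)) (hPMC i hi j hj)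
    rw [hsum, ← add_assoc]
    refine add_mem ?_ hx0C
    rcases hn0.lt_or_eq with hn1 | hn1
    -- The mixed generators absorb all of `xp` and use up the fraction `-p / n` of `xn`. What
    -- remains of `xn` has a nonnegative coefficient because `p + n ≤ 0` and `n < 0`.
    · have : xp + xn = (-n)⁻¹ • (p • xn - n • xp) + (1 + p / n) • xn := by
        have hne : n ≠ 0 := hn1.ne
        match_scalars <;> field_simp; ring
      rw [this]
      refine add_mem (PointedCone.smul_mem _ (by simp [hn0]) hmix)
        (PointedCone.smul_mem _ ?_ hxnC)
      have : (p + n) / n ≥ 0 := div_nonneg_of_nonpos hpn hn0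
      rw [add_div, div_self hn1.ne] at this
      linarith
    -- With no negative part available, the half-space condition forces every generator on the
    -- positive side to have coefficient zero.
    · have hp1 : p = 0 := by linarith
      have hxp0 : xp = 0 := by
        refine Finset.sum_eq_zero fun t ht => ?_
        have h1 := (Finset.sum_eq_zero_iff_of_nonneg fun t ht =>
          mul_nonneg (hc t) (Finset.mem_filter.1 ht).2.le).1 hp1 t ht
        rcases mul_eq_zero.1 h1 with h | h
        · rw [h, zero_smul]
        · exact absurd h (Finset.mem_filter.1 ht).2.ne'
      rw [hxp0, zero_add]
      exact hxnC

/-- A finite intersection of linear half-spaces. -/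
def IsPolyhedralCone (K : Set H) : Prop :=
  ∃ s : Finset H, K = {z | ∀ a ∈ s, inner ℝ a z ≤ 0}

/-- Minkowski–Weyl: a polyhedral cone is finitely generated. -/
theorem IsPolyhedralCone.exists_generators [FiniteDimensional ℝ H] {K : Set H}
    (hK : IsPolyhedralCone K) :
    ∃ T : Finset H, ∀ x, x ∈ K ↔ ∃ c : H → ℝ, (∀ t, 0 ≤ c t) ∧ x = ∑ t ∈ T, c t • t := by
  classical
  obtain ⟨s, rfl⟩ := hK
  suffices h : ∃ T : Finset H, ∀ x, x ∈ PointedCone.hull ℝ (T : Set H) ↔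
      ∀ a ∈ s, inner ℝ a x ≤ 0 by
    obtain ⟨T, hT⟩ := h
    exact ⟨T, fun x => by rw [← mem_hull_finset_iff, hT]; rfl⟩
  induction s using Finset.induction_on with
  | empty =>
    let b := stdOrthonormalBasis ℝ H
    refine ⟨Finset.univ.image b ∪ Finset.univ.image fun i => -b i, fun x => ?_⟩
    simp only [Finset.notMem_empty, false_imp_iff, implies_true, iff_true]
    rw [← b.sum_repr' x]
    refine sum_mem fun i _ => ?_
    rcases le_total 0 (inner ℝ (b i) x) with h | h
    · exact PointedCone.smul_mem _ h (Submodule.subset_span (by simp))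
    · rw [← neg_smul_neg]
      exact PointedCone.smul_mem _ (by linarith) (Submodule.subset_span (by simp))
  | insert a s _ ih =>
    obtain ⟨T, hT⟩ := ih
    obtain ⟨T', hT'⟩ := exists_hull_inter_halfspace T a
    exact ⟨T', fun x => by rw [hT', hT, Finset.forall_mem_insert, and_comm]⟩

end Generators

/-! ### Local structure of polyhedral sets and of their normal cone graphs. -/

section Polyhedral

variable {H : Type*} [NormedAddCommGroup H] [InnerProductSpace ℝ H]

/-- A set that near `x` coincides with a translated closed cone has that cone as tangent cone. -/
lemma tangentCone_eq_of_eventually {A C : Set H} {x : H} (hC : IsClosed C)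
    (hsmul : ∀ t : ℝ, 0 < t → ∀ w ∈ C, t • w ∈ C)
    (h : ∀ᶠ e in 𝓝 (0 : H), x + e ∈ A ↔ e ∈ C) : tangentCone A x = C := by
  ext w
  constructor
  · rintro ⟨t, v, ht, ht0, hv, hA⟩
    have htv : Tendsto (fun i => t i • v i) atTop (𝓝 0) := by simpa using ht0.smul hv
    refine hC.mem_of_tendsto hv ((htv.eventually h).mono fun i hi => ?_)
    have := hsmul (t i)⁻¹ (inv_pos.2 (ht i)) _ (hi.1 (hA i))
    rwa [smul_smul, inv_mul_cancel₀ (ht i).ne', one_smul] at this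
  · intro hw
    have ht : Tendsto (fun i : ℕ => 1 / ((i : ℝ) + 1)) atTop (𝓝 0) :=
      tendsto_one_div_add_atTop_nhds_zero_nat
    have htw : Tendsto (fun i : ℕ => (1 / ((i : ℝ) + 1)) • w) atTop (𝓝 0) := by
      simpa using ht.smul_const w
    obtain ⟨N, hN⟩ := eventually_atTop.1 (htw.eventually h)
    refine ⟨fun i => 1 / (((i + N : ℕ) : ℝ) + 1), fun _ => w, fun i => by positivity,
      ht.comp (tendsto_add_atTop_nat N), tendsto_const_nhds, fun i => ?_⟩
    exact (hN (i + N) (by omega)).2 (hsmul _ (by positivity) _ hw)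

namespace IsPolyhedralCone

variable {K : Set H}

lemma isClosed (hK : IsPolyhedralCone K) : IsClosed K := by
  obtain ⟨s, rfl⟩ := hK
  have : {z | ∀ a ∈ s, inner ℝ a z ≤ 0} = ⋂ a ∈ s, {z | inner ℝ a z ≤ 0} := by
    ext z; simp
  rw [this]
  exact isClosed_biInter fun a _ => isClosed_le (by fun_prop) continuous_const

lemma smul_mem (hK : IsPolyhedralCone K) {t : ℝ} (ht : 0 ≤ t) {x : H} (hx : x ∈ K) :
    t • x ∈ K := by
  obtain ⟨s, rfl⟩ := hK
  intro a ha
  rw [inner_smul_right]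
  exact mul_nonpos_of_nonneg_of_nonpos ht (hx a ha)

lemma add_mem (hK : IsPolyhedralCone K) {x y : H} (hx : x ∈ K) (hy : y ∈ K) : x + y ∈ K := by
  obtain ⟨s, rfl⟩ := hK
  intro a ha
  rw [inner_add_right]
  linarith [hx a ha, hy a ha]

lemma zero_mem (hK : IsPolyhedralCone K) : (0 : H) ∈ K := by
  obtain ⟨s, rfl⟩ := hK
  intro a _
  simp

lemma convex (hK : IsPolyhedralCone K) : Convex ℝ K := fun _ hx _ hy _ _ ha hb _ =>
  hK.add_mem (hK.smul_mem ha hx) (hK.smul_mem hb hy)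

lemma isConvexPolyhedral (hK : IsPolyhedralCone K) : IsConvexPolyhedral K := by
  obtain ⟨s, rfl⟩ := hK
  refine ⟨s.card, fun i => s.equivFin.symm i, fun _ => 0, ?_⟩
  ext z
  constructor
  · intro hz i
    exact hz _ (s.equivFin.symm i).2
  · intro hz a ha
    simpa using hz (s.equivFin ⟨a, ha⟩)

lemma inter_orth (hK : IsPolyhedralCone K) (v : H) : IsPolyhedralCone (K ∩ orth {v}) := by
  classical
  obtain ⟨s, rfl⟩ := hK
  refine ⟨insert v (insert (-v) s), ?_⟩
  ext z
  simp only [orth, Set.mem_inter_iff, Set.mem_ofPred_eq, Set.mem_singleton_iff, forall_eq,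
    Finset.forall_mem_insert, inner_neg_left, real_inner_comm v z]
  constructor
  · rintro ⟨h1, h2⟩
    exact ⟨h2.le, by linarith, h1⟩
  · rintro ⟨h1, h2, h3⟩
    exact ⟨h3, by linarith⟩

lemma mem_normalCone_iff (hK : IsPolyhedralCone K) {x v : H} :
    v ∈ normalCone K x ↔ x ∈ K ∧ v ∈ polar K ∧ inner ℝ v x = 0 := by
  constructor
  · rintro ⟨hx, h⟩
    have h0 := h _ hK.zero_mem
    have h2 := h _ (hK.smul_mem zero_le_two hx)
    rw [inner_sub_right, inner_zero_right] at h0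
    rw [inner_sub_right, inner_smul_right] at h2
    refine ⟨hx, fun w hw => ?_, by linarith⟩
    have := h _ (hK.add_mem hx hw)
    rwa [add_sub_cancel_left] at this
  · rintro ⟨hx, h, h0⟩
    refine ⟨hx, fun z hz => ?_⟩
    rw [inner_sub_right, h0, sub_zero]
    exact h z hz

lemma isClosed_gph_normalCone (hK : IsPolyhedralCone K) : IsClosed (gph (normalCone K)) := by
  have : gph (normalCone K) = {z | z.fst ∈ K} ∩
      ⋂ w ∈ K, {z : WithLp 2 (H × H) | inner ℝ z.snd (w - z.fst) ≤ 0} := by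
    ext z; simp [gph, normalCone]
  rw [this]
  exact (hK.isClosed.preimage (by fun_prop)).inter
    (isClosed_biInter fun w _ => isClosed_le (by fun_prop) continuous_const)

lemma smul_mem_gph_normalCone (hK : IsPolyhedralCone K) {t : ℝ} (ht : 0 < t)
    {w : WithLp 2 (H × H)} (hw : w ∈ gph (normalCone K)) : t • w ∈ gph (normalCone K) := by
  obtain ⟨h1, h2, h3⟩ := hK.mem_normalCone_iff.1 hw
  refine hK.mem_normalCone_iff.2 ⟨hK.smul_mem ht.le h1, fun z hz => ?_, ?_⟩
  · rw [WithLp.smul_snd, inner_smul_left]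
    exact mul_nonpos_of_nonneg_of_nonpos ht.le (h2 z hz)
  · rw [WithLp.smul_snd, WithLp.smul_fst, inner_smul_left, inner_smul_right, h3]
    simp

end IsPolyhedralCone

namespace IsConvexPolyhedral

variable {D : Set H} {d ds : H}

/-- The cone is cut out by the constraints active at `d`; the inactive ones stay satisfied nearby by
continuity. The inclusion of `D - d` is global. -/
lemma exists_local_cone (hD : IsConvexPolyhedral D) (hd : d ∈ D) :
    ∃ T, IsPolyhedralCone T ∧ (∀ z ∈ D, z - d ∈ T) ∧ ∀ᶠ h in 𝓝 (0 : H), h ∈ T → d + h ∈ D := by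
  classical
  obtain ⟨N, a, b, rfl⟩ := hD
  refine ⟨{w | ∀ i, inner ℝ (a i) d = b i → inner ℝ (a i) w ≤ 0}, ?_, ?_, ?_⟩
  · refine ⟨(Finset.univ.filter fun i => inner ℝ (a i) d = b i).image a, ?_⟩
    ext w
    simp
  · intro z hz i hi
    rw [inner_sub_right, hi]
    linarith [hz i]
  · have : ∀ i, ∀ᶠ h in 𝓝 (0 : H), (inner ℝ (a i) d = b i → inner ℝ (a i) h ≤ 0) →
        inner ℝ (a i) (d + h) ≤ b i := by
      intro i
      rcases (hd i).lt_or_eq with h | h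
      · have hc : Tendsto (fun h : H => inner ℝ (a i) (d + h)) (𝓝 0)
            (𝓝 (inner ℝ (a i) (d + 0))) := Continuous.tendsto (by fun_prop) 0
        rw [add_zero] at hc
        exact (hc.eventually (gt_mem_nhds h)).mono fun e he _ => le_of_lt he
      · refine Eventually.of_forall fun e he => ?_
        rw [inner_add_right, h]
        linarith [he h]
    exact (eventually_all.2 this).mono fun h hh hT i => hh i (hT i)

lemma eventually_add_mem_iff (hD : IsConvexPolyhedral D) (hd : d ∈ D) :
    ∀ᶠ h in 𝓝 (0 : H), d + h ∈ D ↔ h ∈ tangentCone D d := by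
  obtain ⟨T, hT, h1, h2⟩ := hD.exists_local_cone hd
  have h3 : ∀ᶠ h in 𝓝 (0 : H), d + h ∈ D ↔ h ∈ T :=
    h2.mono fun h hh => ⟨fun hm => by simpa using h1 _ hm, hh⟩
  rwa [tangentCone_eq_of_eventually hT.isClosed (fun t ht w hw => hT.smul_mem ht.le hw) h3]

lemma isPolyhedralCone_tangentCone (hD : IsConvexPolyhedral D) (hd : d ∈ D) :
    IsPolyhedralCone (tangentCone D d) := by
  obtain ⟨T, hT, h1, h2⟩ := hD.exists_local_cone hd
  have h3 : ∀ᶠ h in 𝓝 (0 : H), d + h ∈ D ↔ h ∈ T :=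
    h2.mono fun h hh => ⟨fun hm => by simpa using h1 _ hm, hh⟩
  rwa [tangentCone_eq_of_eventually hT.isClosed (fun t ht w hw => hT.smul_mem ht.le hw) h3]

lemma sub_mem_tangentCone (hD : IsConvexPolyhedral D) (hd : d ∈ D) {z : H} (hz : z ∈ D) :
    z - d ∈ tangentCone D d := by
  obtain ⟨T, hT, h1, h2⟩ := hD.exists_local_cone hd
  have h3 : ∀ᶠ h in 𝓝 (0 : H), d + h ∈ D ↔ h ∈ T :=
    h2.mono fun h hh => ⟨fun hm => by simpa using h1 _ hm, hh⟩
  rw [tangentCone_eq_of_eventually hT.isClosed (fun t ht w hw => hT.smul_mem ht.le hw) h3]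
  exact h1 z hz

lemma isPolyhedralCone_criticalCone (hD : IsConvexPolyhedral D) (hd : d ∈ D) :
    IsPolyhedralCone (criticalCone D d ds) :=
  (hD.isPolyhedralCone_tangentCone hd).inter_orth ds

/-- Normality is a local condition by convexity: a short step from `e` towards any `w` in the
tangent cone stays in that cone, hence lands in `D` after translation, and the inequality can be
divided by the step length. -/
lemma eventually_normalCone_add_eq (hD : IsConvexPolyhedral D) (hd : d ∈ D) :
    ∀ᶠ h in 𝓝 (0 : H), normalCone D (d + h) = normalCone (tangentCone D d) h := by
  have hT := hD.isPolyhedralCone_tangentCone hd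
  have hloc := hD.eventually_add_mem_iff hd
  filter_upwards [hloc, hloc.eventually_nhds] with e he he'
  ext v
  constructor
  · rintro ⟨h0, h⟩
    have hem := he.1 h0
    refine ⟨hem, fun w hw => ?_⟩
    have hc : Tendsto (fun s : ℝ => e + s • (w - e)) (𝓝[>] 0) (𝓝 e) := by
      have : Tendsto (fun s : ℝ => e + s • (w - e)) (𝓝 0) (𝓝 (e + (0 : ℝ) • (w - e))) :=
        Continuous.tendsto (by fun_prop) 0
      rw [zero_smul, add_zero] at this
      exact this.mono_left nhdsWithin_le_nhds
    have h1 : ∀ᶠ s : ℝ in 𝓝[>] 0, s < 1 := nhdsWithin_le_nhds (gt_mem_nhds one_pos)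
    obtain ⟨s, hs, hs1, hs0⟩ :=
      ((hc.eventually he').and (h1.and self_mem_nhdsWithin)).exists
    have hs0 : 0 < s := hs0
    have hmem : e + s • (w - e) ∈ tangentCone D d := by
      have : e + s • (w - e) = (1 - s) • e + s • w := by module
      rw [this]
      exact hT.add_mem (hT.smul_mem (by linarith) hem) (hT.smul_mem hs0.le hw)
    have h2 := h _ (hs.2 hmem)
    have : d + (e + s • (w - e)) - (d + e) = s • (w - e) := by module
    rw [this, inner_smul_right] at h2
    exact nonpos_of_mul_nonpos_right h2 hs0
  · rintro ⟨h0, h⟩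
    refine ⟨he.2 h0, fun z hz => ?_⟩
    have := h _ (hD.sub_mem_tangentCone hd hz)
    rwa [sub_sub] at this

lemma mem_tangentCone_iff (hD : IsConvexPolyhedral D) (hd : d ∈ D) {w : H} :
    w ∈ tangentCone D d ↔ ∃ s : ℝ, 0 < s ∧ d + s • w ∈ D := by
  have hT := hD.isPolyhedralCone_tangentCone hd
  constructor
  · intro hw
    have hc : Tendsto (fun s : ℝ => s • w) (𝓝[>] 0) (𝓝 0) := by
      have : Tendsto (fun s : ℝ => s • w) (𝓝 0) (𝓝 ((0 : ℝ) • w)) :=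
        Continuous.tendsto (by fun_prop) 0
      rw [zero_smul] at this
      exact this.mono_left nhdsWithin_le_nhds
    obtain ⟨s, hs, hs0⟩ :=
      ((hc.eventually (hD.eventually_add_mem_iff hd)).and self_mem_nhdsWithin).exists
    have hs0 : 0 < s := hs0
    exact ⟨s, hs0, hs.2 (hT.smul_mem hs0.le hw)⟩
  · rintro ⟨s, hs, h⟩
    have h1 := hD.sub_mem_tangentCone hd h
    rw [add_sub_cancel_left] at h1
    simpa [smul_smul, inv_mul_cancel₀ hs.ne'] using hT.smul_mem (inv_pos.2 hs).le h1

lemma mem_polar_tangentCone (hD : IsConvexPolyhedral D) (h : ds ∈ normalCone D d) :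
    ds ∈ polar (tangentCone D d) := by
  intro w hw
  obtain ⟨s, hs, hsD⟩ := (hD.mem_tangentCone_iff h.1).1 hw
  have := h.2 _ hsD
  rw [add_sub_cancel_left, inner_smul_right] at this
  exact nonpos_of_mul_nonpos_right this hs

end IsConvexPolyhedral

lemma IsPolyhedralCone.sum_mem {K : Set H} (hK : IsPolyhedralCone K) {s : Finset H} {f : H → H}
    (h : ∀ t ∈ s, f t ∈ K) : ∑ t ∈ s, f t ∈ K := by
  classical
  induction s using Finset.induction_on with
  | empty => simpa using hK.zero_mem
  | insert a s ha ih =>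
    rw [Finset.sum_insert ha]
    exact hK.add_mem (h a (by simp)) (ih fun t ht => h t (by simp [ht]))

section Generated

variable [FiniteDimensional ℝ H]

lemma IsPolyhedralCone.exists_generators_mem {K : Set H} (hK : IsPolyhedralCone K) :
    ∃ T : Finset H, (∀ t ∈ T, t ∈ K) ∧
      ∀ x ∈ K, ∃ c : H → ℝ, (∀ t, 0 ≤ c t) ∧ x = ∑ t ∈ T, c t • t := by
  classical
  obtain ⟨T, hT⟩ := hK.exists_generators
  refine ⟨T, fun t ht => (hT t).2 ⟨fun s => if s = t then 1 else 0, fun s => ?_, ?_⟩,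
    fun x hx => (hT x).1 hx⟩
  · dsimp only; split_ifs <;> norm_num
  · simp [ite_smul, ht]

/-- Small shifts of a polar vector `ds` that remain normal to the cone `T` are the normals to the
face of `T` exposed by `ds`. -/
lemma IsPolyhedralCone.eventually_add_mem_normalCone_iff {T : Set H} (hT : IsPolyhedralCone T)
    {ds : H} (hds : ds ∈ polar T) :
    ∀ᶠ f in 𝓝 (0 : H), ∀ e, ds + f ∈ normalCone T e ↔ f ∈ normalCone (T ∩ orth {ds}) e := by
  obtain ⟨s, hs, hgen⟩ := hT.exists_generators_mem
  -- Finitely many generators make one neighborhood of `f` work for every `e` at once.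
  have hlt : ∀ᶠ f in 𝓝 (0 : H), ∀ t ∈ s, inner ℝ ds t < 0 → inner ℝ (ds + f) t < 0 := by
    refine (Finset.eventually_all s).2 fun t _ => ?_
    by_cases h : inner ℝ ds t < 0
    · have hc : Tendsto (fun f : H => inner ℝ (ds + f) t) (𝓝 0) (𝓝 (inner ℝ (ds + 0) t)) :=
        Continuous.tendsto (by fun_prop) 0
      rw [add_zero] at hc
      exact (hc.eventually (gt_mem_nhds h)).mono fun _ h _ => h
    · exact Eventually.of_forall fun _ h' => absurd h' h
  refine hlt.mono fun f hf e => ?_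
  rw [hT.mem_normalCone_iff, (hT.inter_orth ds).mem_normalCone_iff]
  constructor
  · rintro ⟨he, hp, h0⟩
    obtain ⟨c, hc, rfl⟩ := hgen e he
    -- Complementary slackness: nonpositive terms with zero sum all vanish, so only generators
    -- orthogonal to `ds` can carry weight in `e`.
    have hz : ∀ t ∈ s, c t * inner ℝ (ds + f) t = 0 := by
      rw [inner_sum] at h0
      simp only [inner_smul_right] at h0
      exact (Finset.sum_eq_zero_iff_of_nonpos fun t ht =>
        mul_nonpos_of_nonneg_of_nonpos (hc t) (hp t (hs t ht))).1 h0
    have hds0 : inner ℝ ds (∑ t ∈ s, c t • t) = 0 := by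
      rw [inner_sum]
      refine Finset.sum_eq_zero fun t ht => ?_
      rw [inner_smul_right]
      rcases mul_eq_zero.1 (hz t ht) with h | h
      · rw [h, zero_mul]
      · rcases (hds t (hs t ht)).lt_or_eq with h' | h'
        · exact absurd h (hf t ht h').ne
        · rw [h', mul_zero]
    refine ⟨⟨he, ?_⟩, ?_, ?_⟩
    · rintro _ rfl
      rw [real_inner_comm, hds0]
    · intro w hw
      have h1 := hp w hw.1
      have h2 := hw.2 ds rfl
      rw [real_inner_comm] at h2
      rwa [inner_add_left, h2, zero_add] at h1
    · rwa [inner_add_left, hds0, zero_add] at h0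
  · rintro ⟨he, hp, h0⟩
    have h2 := he.2 ds rfl
    rw [real_inner_comm] at h2
    refine ⟨he.1, fun w hw => ?_, by rw [inner_add_left, h2, h0, add_zero]⟩
    obtain ⟨c, hc, rfl⟩ := hgen w hw
    rw [inner_sum]
    refine Finset.sum_nonpos fun t ht => ?_
    rw [inner_smul_right]
    refine mul_nonpos_of_nonneg_of_nonpos (hc t) ?_
    rcases (hds t (hs t ht)).lt_or_eq with h' | h'
    · exact (hf t ht h').le
    · rw [inner_add_left, h', zero_add]
      refine hp t ⟨hs t ht, ?_⟩
      rintro _ rfl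
      rwa [real_inner_comm]

namespace IsConvexPolyhedral

variable {D : Set H} {d ds : H}

/-- The reduction lemma: locally, the graph of the normal cone mapping of a polyhedral set is a
translate of the graph of the normal cone mapping of the critical cone. -/
theorem eventually_add_mem_gph_normalCone_iff (hD : IsConvexPolyhedral D)
    (h : ds ∈ normalCone D d) :
    ∀ᶠ e in 𝓝 (0 : WithLp 2 (H × H)), WithLp.toLp 2 (d, ds) + e ∈ gph (normalCone D) ↔
      e ∈ gph (normalCone (criticalCone D d ds)) := by
  have h1 : Tendsto (fun e : WithLp 2 (H × H) => e.fst) (𝓝 0) (𝓝 0) :=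
    Continuous.tendsto' (by fun_prop) _ _ rfl
  have h2 : Tendsto (fun e : WithLp 2 (H × H) => e.snd) (𝓝 0) (𝓝 0) :=
    Continuous.tendsto' (by fun_prop) _ _ rfl
  filter_upwards [h1.eventually (hD.eventually_normalCone_add_eq h.1),
    h2.eventually ((hD.isPolyhedralCone_tangentCone h.1).eventually_add_mem_normalCone_iff
      (hD.mem_polar_tangentCone h))] with e he1 he2
  change ds + e.snd ∈ normalCone D (d + e.fst) ↔ _
  rw [he1, he2]
  rfl

theorem tangentCone_gph_normalCone (hD : IsConvexPolyhedral D) (h : ds ∈ normalCone D d) :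
    tangentCone (gph (normalCone D)) (WithLp.toLp 2 (d, ds)) =
      gph (normalCone (criticalCone D d ds)) :=
  have hK := hD.isPolyhedralCone_criticalCone (ds := ds) h.1
  tangentCone_eq_of_eventually hK.isClosed_gph_normalCone
    (fun _ ht _ hw => hK.smul_mem_gph_normalCone ht hw)
    (hD.eventually_add_mem_gph_normalCone_iff h)

end IsConvexPolyhedral

end Generated

end Polyhedral

/-! ### Faces of a polyhedral cone and critical cones as differences of faces. -/

section Faces

variable {H : Type*} [NormedAddCommGroup H] [InnerProductSpace ℝ H]

/-- The smallest face of the cone `K` that contains `v`. -/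
def minimalFace (K : Set H) (v : H) : Set H :=
  {z | z ∈ K ∧ ∃ ε : ℝ, 0 < ε ∧ v - ε • z ∈ K}

lemma IsFace.subset {K F : Set H} (hF : IsFace K F) : F ⊆ K := hF.2.2.subset

namespace IsPolyhedralCone

variable {K F F₁ F₂ : Set H}

lemma two_smul_mem_face_and_zero_mem_face (hK : IsPolyhedralCone K) (hF : IsFace K F) {x : H} (hx : x ∈ F) :
    (2 : ℝ) • x ∈ F ∧ (0 : H) ∈ F := by
  have hseg : x ∈ openSegment ℝ ((2 : ℝ) • x) 0 :=
    ⟨1 / 2, 1 / 2, by norm_num, by norm_num, by norm_num, by module⟩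
  have h2 := hK.smul_mem zero_le_two (hF.subset hx)
  exact ⟨hF.2.2.left_mem_of_mem_openSegment h2 hK.zero_mem hx hseg,
    hF.2.2.right_mem_of_mem_openSegment h2 hK.zero_mem hx hseg⟩

lemma zero_mem_face (hK : IsPolyhedralCone K) (hF : IsFace K F) : (0 : H) ∈ F := by
  obtain ⟨x, hx⟩ := hF.1
  exact (hK.two_smul_mem_face_and_zero_mem_face hF hx).2

lemma add_mem_face (hK : IsPolyhedralCone K) (hF : IsFace K F) {x y : H} (hx : x ∈ F)
    (hy : y ∈ F) : x + y ∈ F := by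
  have := hF.2.1 (hK.two_smul_mem_face_and_zero_mem_face hF hx).1 (hK.two_smul_mem_face_and_zero_mem_face hF hy).1
    (show (0 : ℝ) ≤ 1 / 2 by norm_num) (show (0 : ℝ) ≤ 1 / 2 by norm_num) (by norm_num)
  convert this using 1
  module

lemma mem_face_of_add_mem (hK : IsPolyhedralCone K) (hF : IsFace K F) {x y : H} (hx : x ∈ K)
    (hy : y ∈ K) (hxy : x + y ∈ F) : x ∈ F := by
  have h2 : (2 : ℝ) • x ∈ F := hF.2.2.left_mem_of_mem_openSegment (hK.smul_mem zero_le_two hx)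
    (hK.smul_mem zero_le_two hy) hxy
    ⟨1 / 2, 1 / 2, by norm_num, by norm_num, by norm_num, by module⟩
  have := hF.2.1 h2 (hK.zero_mem_face hF) (show (0 : ℝ) ≤ 1 / 2 by norm_num)
    (show (0 : ℝ) ≤ 1 / 2 by norm_num) (by norm_num)
  convert this using 1
  module

lemma smul_mem_face (hK : IsPolyhedralCone K) (hF : IsFace K F) {t : ℝ} (ht : 0 ≤ t) {x : H}
    (hx : x ∈ F) : t • x ∈ F := by
  have h0 := hK.zero_mem_face hF
  have hx' := hF.subset hx
  have hnat : ∀ n : ℕ, (n : ℝ) • x ∈ F := by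
    intro n
    induction n with
    | zero => simpa using h0
    | succ n ih =>
      rw [Nat.cast_succ, add_smul, one_smul]
      exact hK.add_mem_face hF ih hx
  obtain ⟨n, hn⟩ := exists_nat_ge t
  -- Natural multiples of `x` lie in the face, and `t • x` is a summand in `K` of one of them.
  refine hK.mem_face_of_add_mem hF (y := (n - t) • x) (hK.smul_mem ht hx')
    (hK.smul_mem (by linarith) hx') ?_
  rw [← add_smul, add_sub_cancel]
  exact hnat n

lemma mem_face_of_smul_mem (hK : IsPolyhedralCone K) (hF : IsFace K F) {t : ℝ} (ht : 0 < t) {x : H}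
    (hx : t • x ∈ F) : x ∈ F := by
  simpa [smul_smul, inv_mul_cancel₀ ht.ne'] using hK.smul_mem_face hF (inv_pos.2 ht).le hx

lemma sum_mem_face (hK : IsPolyhedralCone K) (hF : IsFace K F) {s : Finset H} {f : H → H}
    (h : ∀ t ∈ s, f t ∈ F) : ∑ t ∈ s, f t ∈ F := by
  classical
  induction s using Finset.induction_on with
  | empty => simpa using hK.zero_mem_face hF
  | insert a s ha ih =>
    rw [Finset.sum_insert ha]
    exact hK.add_mem_face hF (h a (by simp)) (ih fun t ht => h t (by simp [ht]))

lemma mem_face_of_sum_mem (hK : IsPolyhedralCone K) (hF : IsFace K F) {s : Finset H} {f : H → H}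
    (h : ∀ t ∈ s, f t ∈ K) (hs : ∑ t ∈ s, f t ∈ F) {t : H} (ht : t ∈ s) : f t ∈ F := by
  classical
  rw [← Finset.add_sum_erase s f ht] at hs
  exact hK.mem_face_of_add_mem hF (h t ht)
    (hK.sum_mem fun u hu => h u (Finset.mem_of_mem_erase hu)) hs

lemma isFace_inter_orth (hK : IsPolyhedralCone K) {vs : H} (hvs : vs ∈ polar K) :
    IsFace K (K ∩ orth {vs}) := by
  refine ⟨⟨0, (hK.inter_orth vs).zero_mem⟩, (hK.inter_orth vs).convex,
    Set.inter_subset_left, ?_⟩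
  rintro x hx y hy z ⟨hz, hz0⟩ ⟨a, b, ha, hb, -, rfl⟩
  refine ⟨hx, ?_⟩
  rintro _ rfl
  have h := hz0 _ rfl
  rw [real_inner_comm, inner_add_right, inner_smul_right, inner_smul_right] at h
  have h1 := hvs x hx
  have h2 := hvs y hy
  have h3 := mul_nonpos_of_nonneg_of_nonpos hb.le h2
  rw [real_inner_comm]
  refine le_antisymm h1 (nonneg_of_mul_nonneg_right (a := a) ?_ ha)
  linarith

lemma self_mem_minimalFace (hK : IsPolyhedralCone K) {v : H} (hv : v ∈ K) :
    v ∈ minimalFace K v :=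
  ⟨hv, 1, one_pos, by simpa using hK.zero_mem⟩

lemma sub_smul_mem_of_le (hK : IsPolyhedralCone K) {v z : H} (hz : z ∈ K) {ε δ : ℝ}
    (h : v - ε • z ∈ K) (hδ : δ ≤ ε) : v - δ • z ∈ K := by
  have := hK.add_mem h (hK.smul_mem (sub_nonneg.2 hδ) hz)
  convert this using 1
  module

lemma isFace_minimalFace (hK : IsPolyhedralCone K) {v : H} (hv : v ∈ K) :
    IsFace K (minimalFace K v) := by
  refine ⟨⟨v, hK.self_mem_minimalFace hv⟩, ?_, fun _ h => h.1, ?_⟩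
  · rintro x ⟨hx, ε, hε, hxε⟩ y ⟨hy, δ, hδ, hyδ⟩ a b ha hb hab
    refine ⟨hK.convex hx hy ha hb hab, min ε δ, lt_min hε hδ, ?_⟩
    have := hK.convex (hK.sub_smul_mem_of_le hx hxε (min_le_left ε δ))
      (hK.sub_smul_mem_of_le hy hyδ (min_le_right ε δ)) ha hb hab
    convert this using 1
    obtain rfl : b = 1 - a := by linarith
    module
  · rintro x hx y hy z ⟨hz, ε, hε, hzε⟩ ⟨a, b, ha, hb, -, rfl⟩
    -- Here `v - (ε * a) • x` equals `(v - ε • (a • x + b • y)) + (ε * b) • y`, a sum of two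
    -- elements of `K`.
    refine ⟨hx, ε * a, by positivity, ?_⟩
    have := hK.add_mem hzε (hK.smul_mem (t := ε * b) (by positivity) hy)
    convert this using 1
    module

lemma minimalFace_smul (hK : IsPolyhedralCone K) {t : ℝ} (ht : 0 < t) (v : H) :
    minimalFace K (t • v) = minimalFace K v := by
  have key : ∀ (t : ℝ), 0 < t → ∀ v, minimalFace K v ⊆ minimalFace K (t • v) := by
    rintro t ht v z ⟨hz, ε, hε, h⟩
    refine ⟨hz, t * ε, by positivity, ?_⟩
    rw [mul_smul, ← smul_sub]
    exact hK.smul_mem ht.le h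
  refine (key t ht v).antisymm' ?_
  have := key t⁻¹ (inv_pos.2 ht) (t • v)
  rwa [smul_smul, inv_mul_cancel₀ ht.ne', one_smul] at this

lemma minimalFace_subset_inter_orth (hK : IsPolyhedralCone K) {v vs : H}
    (h : vs ∈ normalCone K v) : minimalFace K v ⊆ K ∩ orth {vs} := by
  rintro z ⟨hz, ε, hε, hzε⟩
  obtain ⟨-, hp, h0⟩ := hK.mem_normalCone_iff.1 h
  refine ⟨hz, ?_⟩
  rintro _ rfl
  have h1 := hp _ hzε
  rw [inner_sub_right, inner_smul_right, h0] at h1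
  rw [real_inner_comm]
  refine le_antisymm (hp z hz) (nonneg_of_mul_nonneg_right (a := ε) ?_ hε)
  linarith

/-- A critical cone of a polyhedral cone is a difference of two of its faces. -/
lemma criticalCone_eq_sub (hK : IsPolyhedralCone K) {v vs : H} (h : vs ∈ normalCone K v) :
    criticalCone K v vs = (K ∩ orth {vs}) - minimalFace K v := by
  obtain ⟨hv, hp, h0⟩ := hK.mem_normalCone_iff.1 h
  ext w
  constructor
  · rintro ⟨hw, hw0⟩
    obtain ⟨s, hs, hsw⟩ := (hK.isConvexPolyhedral.mem_tangentCone_iff hv).1 hw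
    -- A feasible step `v + s • w ∈ K` exhibits `w` as a difference after rescaling by `s⁻¹`.
    refine ⟨s⁻¹ • (v + s • w), ⟨hK.smul_mem (inv_pos.2 hs).le hsw, ?_⟩, s⁻¹ • v,
      hK.smul_mem_face (hK.isFace_minimalFace hv) (inv_pos.2 hs).le (hK.self_mem_minimalFace hv),
      ?_⟩
    · rintro _ rfl
      rw [inner_smul_left, inner_add_left, inner_smul_left, hw0 _ rfl, real_inner_comm, h0]
      simp
    · dsimp only
      rw [smul_add, smul_smul, inv_mul_cancel₀ hs.ne', one_smul, add_sub_cancel_left]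
  · rintro ⟨x, hx, z, hz, rfl⟩
    have hz' := hK.minimalFace_subset_inter_orth h hz
    obtain ⟨-, ε, hε, hzε⟩ := hz
    refine ⟨(hK.isConvexPolyhedral.mem_tangentCone_iff hv).2 ⟨ε, hε, ?_⟩, ?_⟩
    · have := hK.add_mem hzε (hK.smul_mem hε.le hx.1)
      convert this using 1
      dsimp only
      module
    · rintro _ rfl
      dsimp only
      rw [inner_sub_left, hx.2 _ rfl, hz'.2 _ rfl, sub_zero]

/-- If the difference of two nested faces is a subspace, then it is the span of the larger face. -/
lemma sub_eq_sub_self (hK : IsPolyhedralCone K) (hF₂ : IsFace K F₂) (h : F₂ ⊆ F₁)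
    {S : Submodule ℝ H} (hS : (S : Set H) = F₁ - F₂) : F₁ - F₂ = F₁ - F₁ := by
  refine (Set.sub_subset_sub_left h).antisymm ?_
  have h1 : ∀ x ∈ F₁, x ∈ S := fun x hx => by
    rw [← SetLike.mem_coe, hS]
    exact ⟨x, hx, 0, hK.zero_mem_face hF₂, sub_zero x⟩
  rintro _ ⟨x, hx, y, hy, rfl⟩
  rw [← hS]
  exact S.sub_mem (h1 x hx) (h1 y hy)

lemma sub_self_eq_span (hK : IsPolyhedralCone K) (hF : IsFace K F) :
    F - F = Submodule.span ℝ F := by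
  apply Set.Subset.antisymm
  · rintro _ ⟨x, hx, y, hy, rfl⟩
    exact Submodule.sub_mem _ (Submodule.subset_span hx) (Submodule.subset_span hy)
  · intro z hz
    induction hz using Submodule.span_induction with
    | mem x hx => exact ⟨x, hx, 0, hK.zero_mem_face hF, sub_zero x⟩
    | zero => exact ⟨0, hK.zero_mem_face hF, 0, hK.zero_mem_face hF, sub_zero 0⟩
    | add x y _ _ hx hy =>
      obtain ⟨a, ha, b, hb, rfl⟩ := hx
      obtain ⟨c, hc, d, hd, rfl⟩ := hy
      exact ⟨a + c, hK.add_mem_face hF ha hc, b + d, hK.add_mem_face hF hb hd, by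
        dsimp only; abel⟩
    | smul r x _ hx =>
      obtain ⟨a, ha, b, hb, rfl⟩ := hx
      rcases le_total 0 r with hr | hr
      · exact ⟨r • a, hK.smul_mem_face hF hr ha, r • b, hK.smul_mem_face hF hr hb, by
          dsimp only; module⟩
      · exact ⟨(-r) • b, hK.smul_mem_face hF (by linarith) hb, (-r) • a,
          hK.smul_mem_face hF (by linarith) ha, by dsimp only; module⟩

variable [FiniteDimensional ℝ H]

/-- A face is determined by which members of a finite generating set it contains: if a conic
combination lies in a face, so does every generator with positive coefficient. -/
lemma finite_faces (hK : IsPolyhedralCone K) : {F | IsFace K F}.Finite := by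
  classical
  obtain ⟨T, hT, hgen⟩ := hK.exists_generators_mem
  refine Set.Finite.of_finite_image (f := fun F => T.filter (· ∈ F))
    (T.powerset.finite_toSet.subset ?_) ?_
  · rintro _ ⟨F, -, rfl⟩
    exact Finset.mem_coe.2 (Finset.mem_powerset.2 (Finset.filter_subset _ _))
  · have key : ∀ F G, IsFace K F → IsFace K G → T.filter (· ∈ F) = T.filter (· ∈ G) → F ⊆ G := by
      intro F G hF hG hFG x hx
      obtain ⟨c, hc, rfl⟩ := hgen x (hF.subset hx)
      refine hK.sum_mem_face hG fun t ht => ?_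
      have hct := hK.mem_face_of_sum_mem hF (fun t ht => hK.smul_mem (hc t) (hT t ht)) hx ht
      rcases (hc t).eq_or_lt with h | h
      · rw [← h, zero_smul]
        exact hK.zero_mem_face hG
      · have : t ∈ T.filter (· ∈ F) :=
          Finset.mem_filter.2 ⟨ht, hK.mem_face_of_smul_mem hF h hct⟩
        rw [hFG] at this
        exact hK.smul_mem_face hG h.le (Finset.mem_filter.1 this).2
    intro F hF G hG hFG
    exact (key F G hF hG hFG).antisymm (key G F hG hF hFG.symm)

/-- Every face of a polyhedral cone has a relative interior point. -/
lemma exists_minimalFace_eq (hK : IsPolyhedralCone K) (hF : IsFace K F) :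
    ∃ v ∈ F, minimalFace K v = F := by
  classical
  obtain ⟨T, hT, hgen⟩ := hK.exists_generators_mem
  -- The relative interior point is the sum of all generators lying in `F`.
  have hv : ∑ t ∈ T, (if t ∈ F then t else 0) ∈ F := hK.sum_mem_face hF fun t _ => by
    split_ifs with h
    · exact h
    · exact hK.zero_mem_face hF
  refine ⟨_, hv, Set.Subset.antisymm ?_ ?_⟩
  · rintro z ⟨hz, ε, hε, h⟩
    refine hK.mem_face_of_smul_mem hF hε (hK.mem_face_of_add_mem hF (hK.smul_mem hε.le hz) h ?_)
    rwa [add_sub_cancel]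
  · intro z hz
    refine ⟨hF.subset hz, ?_⟩
    obtain ⟨c, hc, rfl⟩ := hgen z (hF.subset hz)
    have hs : 0 ≤ ∑ t ∈ T, c t := Finset.sum_nonneg fun t _ => hc t
    -- This scaling brings every coefficient `c t` to at most `1`, the weight of each generator of
    -- `F` in the sum; the added `1` avoids division by zero.
    refine ⟨(1 + ∑ t ∈ T, c t)⁻¹, by positivity, ?_⟩
    rw [Finset.smul_sum, ← Finset.sum_sub_distrib]
    refine hK.sum_mem fun t ht => ?_
    have hct := hK.mem_face_of_sum_mem hF (fun t ht => hK.smul_mem (hc t) (hT t ht)) hz ht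
    rcases (hc t).eq_or_lt with h | h
    · rw [← h, zero_smul, smul_zero, sub_zero]
      split_ifs
      · exact hT t ht
      · exact hK.zero_mem
    · rw [if_pos (hK.mem_face_of_smul_mem hF h hct)]
      have : t - (1 + ∑ t ∈ T, c t)⁻¹ • c t • t = (1 - (1 + ∑ t ∈ T, c t)⁻¹ * c t) • t := by
        module
      rw [this]
      refine hK.smul_mem ?_ (hT t ht)
      rw [sub_nonneg, inv_mul_le_iff₀ (by positivity), mul_one]
      linarith [Finset.single_le_sum (fun t _ => hc t) ht]

/-- Every face of a polyhedral cone is exposed. -/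
lemma exists_exposing (hK : IsPolyhedralCone K) (hF : IsFace K F) :
    ∃ vs ∈ polar K, K ∩ orth {vs} = F := by
  classical
  obtain ⟨v, hv, rfl⟩ := hK.exists_minimalFace_eq hF
  obtain ⟨s, rfl⟩ := id hK
  set K := {z : H | ∀ a ∈ s, inner ℝ a z ≤ 0}
  -- The sum of the constraints active at a relative interior point `v` exposes the face: a `z ∈ K`
  -- orthogonal to it annihilates each of them, and the inactive ones leave room for a small step
  -- from `v` along `-z`.
  set vs := ∑ a ∈ s with inner ℝ a v = 0, a with hvs
  have hinner : ∀ z, inner ℝ vs z = ∑ a ∈ s with inner ℝ a v = 0, inner ℝ a z := fun z => by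
    rw [hvs, sum_inner]
  have hterm : ∀ z ∈ K, ∀ a ∈ s.filter fun a => inner ℝ a v = 0, inner ℝ a z ≤ 0 :=
    fun z hz a ha => hz a (Finset.mem_filter.1 ha).1
  have hp : vs ∈ polar K := fun z hz => by
    rw [hinner]
    exact Finset.sum_nonpos (hterm z hz)
  have hn : vs ∈ normalCone K v := hK.mem_normalCone_iff.2 ⟨hF.subset hv, hp, by
    rw [hinner]
    exact Finset.sum_eq_zero fun a ha => (Finset.mem_filter.1 ha).2⟩
  refine ⟨vs, hp, Set.Subset.antisymm ?_ (hK.minimalFace_subset_inter_orth hn)⟩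
  rintro z ⟨hz, hz0⟩
  have hz1 := hz0 _ rfl
  rw [real_inner_comm, hinner, Finset.sum_eq_zero_iff_of_nonpos (hterm z hz)] at hz1
  have hev : ∀ᶠ ε : ℝ in 𝓝[>] 0, ∀ a ∈ s, inner ℝ a (v - ε • z) ≤ 0 := by
    refine (Finset.eventually_all s).2 fun a ha => ?_
    rcases (hF.subset hv a ha).lt_or_eq with h | h
    · have hc : Tendsto (fun ε : ℝ => inner ℝ a (v - ε • z)) (𝓝 0) (𝓝 (inner ℝ a v)) :=
        Continuous.tendsto' (by fun_prop) _ _ (by simp)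
      exact nhdsWithin_le_nhds ((hc.eventually (gt_mem_nhds h)).mono fun _ h => le_of_lt h)
    · refine Eventually.of_forall fun ε => ?_
      rw [inner_sub_right, inner_smul_right, h, hz1 a (Finset.mem_filter.2 ⟨ha, h⟩)]
      simp
  obtain ⟨ε, hε, hε0⟩ := (hev.and self_mem_nhdsWithin).exists
  exact ⟨hz, ε, hε0, hε⟩

/-- Every difference of nested faces is a critical cone, at points arbitrarily close to `0`. -/
lemma exists_criticalCone_eq_sub (hK : IsPolyhedralCone K) (hF₁ : IsFace K F₁)
    (hF₂ : IsFace K F₂) (h : F₂ ⊆ F₁) :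
    ∃ v vs, ∀ t : ℝ, 0 < t → t • vs ∈ normalCone K (t • v) ∧
      criticalCone K (t • v) (t • vs) = F₁ - F₂ := by
  obtain ⟨v, hv, hvF⟩ := hK.exists_minimalFace_eq hF₂
  obtain ⟨vs, hvs, hvsF⟩ := hK.exists_exposing hF₁
  have h0 : inner ℝ vs v = 0 := by
    have := (hvsF ▸ h hv : v ∈ K ∩ orth {vs}).2 _ rfl
    rwa [real_inner_comm]
  have hn : vs ∈ normalCone K v := hK.mem_normalCone_iff.2 ⟨hF₂.subset hv, hvs, h0⟩
  refine ⟨v, vs, fun t ht => ?_⟩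
  have hnt : t • vs ∈ normalCone K (t • v) :=
    hK.smul_mem_gph_normalCone ht (w := WithLp.toLp 2 (v, vs)) hn
  refine ⟨hnt, ?_⟩
  rw [hK.criticalCone_eq_sub hnt, hK.minimalFace_smul ht, hvF, ← hvsF]
  congr 2
  ext z
  simp [orth, inner_smul_right, ht.ne']

end IsPolyhedralCone

end Faces

/-! ### Tangent cones, submersions and perturbed surjective operators. -/

section TangentCones

variable {X Y : Type*} [NormedAddCommGroup X] [InnerProductSpace ℝ X]
  [NormedAddCommGroup Y] [InnerProductSpace ℝ Y]

lemma mem_tangentCone_of_eventually {A : Set X} {x w : X} {t : ℕ → ℝ} {v : ℕ → X}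
    (ht : ∀ i, 0 < t i) (ht0 : Tendsto t atTop (𝓝 0)) (hv : Tendsto v atTop (𝓝 w))
    (h : ∀ᶠ i in atTop, x + t i • v i ∈ A) : w ∈ tangentCone A x := by
  obtain ⟨N, hN⟩ := eventually_atTop.1 h
  exact ⟨fun i => t (i + N), fun i => v (i + N), fun i => ht _,
    ht0.comp (tendsto_add_atTop_nat N), hv.comp (tendsto_add_atTop_nat N),
    fun i => hN _ (by omega)⟩

lemma mem_tangentCone_of_eventually_nhdsGT {A : Set X} {x w : X}
    (h : ∀ᶠ t : ℝ in 𝓝[>] 0, x + t • w ∈ A) : w ∈ tangentCone A x := by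
  have ht : Tendsto (fun i : ℕ => 1 / ((i : ℝ) + 1)) atTop (𝓝[>] 0) :=
    tendsto_nhdsWithin_iff.2 ⟨tendsto_one_div_add_atTop_nhds_zero_nat,
      Eventually.of_forall fun i => Set.mem_Ioi.2 (by positivity)⟩
  exact mem_tangentCone_of_eventually (fun i => by positivity)
    tendsto_one_div_add_atTop_nhds_zero_nat tendsto_const_nhds (ht.eventually h)

lemma tangentCone_congr {A A' : Set X} {x x' : X}
    (h : ∀ᶠ e in 𝓝 (0 : X), x + e ∈ A ↔ x' + e ∈ A') : tangentCone A x = tangentCone A' x' := by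
  have key : ∀ {A A' : Set X} {x x' : X}, (∀ᶠ e in 𝓝 (0 : X), x + e ∈ A ↔ x' + e ∈ A') →
      tangentCone A x ⊆ tangentCone A' x' := by
    rintro A A' x x' h w ⟨t, v, ht, ht0, hv, hA⟩
    have htv : Tendsto (fun i => t i • v i) atTop (𝓝 0) := by simpa using ht0.smul hv
    exact mem_tangentCone_of_eventually ht ht0 hv
      ((htv.eventually h).mono fun i hi => hi.1 (hA i))
  exact (key h).antisymm (key (h.mono fun _ h => h.symm))

/-- A submersion can be straightened to its derivative by a local change of variables. -/
lemma exists_straightening [CompleteSpace X] [FiniteDimensional ℝ Y] {f : X → Y} {B : X →L[ℝ] Y}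
    {x : X} (hf : HasStrictFDerivAt f B x) (hB : Function.Surjective B) :
    ∃ φ : X → X, HasStrictFDerivAt φ (ContinuousLinearMap.id ℝ X) 0 ∧ φ 0 = x ∧
      ∀ᶠ h in 𝓝 (0 : X), f (φ h) = f x + B h := by
  obtain ⟨R, hR⟩ := B.exists_rightInverse_of_surjective (LinearMap.range_eq_top.2 hB)
  have hBR : ∀ y, B (R y) = y := fun y => DFunLike.congr_fun hR y
  -- This map has derivative the identity at `x` and satisfies `B ∘ θ = f`; its local inverse,
  -- recentred at `θ x`, is the change of variables.
  let θ : X → X := fun y => y + R (f y - B y)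
  have hθ : HasStrictFDerivAt θ ((ContinuousLinearEquiv.refl ℝ X : X ≃L[ℝ] X) : X →L[ℝ] X) x := by
    have h1 := (hasStrictFDerivAt_id (𝕜 := ℝ) x).add
      (R.hasStrictFDerivAt.comp x (hf.sub B.hasStrictFDerivAt))
    refine h1.congr_fderiv ?_
    ext v
    simp
  have hBθ : ∀ y, B (θ y) = f y := fun y => by simp [θ, hBR]
  have htrans : HasStrictFDerivAt (fun h : X => θ x + h) (ContinuousLinearMap.id ℝ X) 0 :=
    (hasStrictFDerivAt_id (𝕜 := ℝ) (0 : X)).const_add _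
  refine ⟨fun h => hθ.localInverse θ _ x (θ x + h), ?_, ?_, ?_⟩
  · have h1 := hθ.to_localInverse
    rw [← add_zero (θ x)] at h1
    exact (h1.comp (0 : X) htrans).congr_fderiv (by ext; simp)
  · simp
  · have h1 : Tendsto (fun h : X => θ x + h) (𝓝 0) (𝓝 (θ x)) :=
      Continuous.tendsto' (by fun_prop) _ _ (by simp)
    refine (h1.eventually hθ.eventually_right_inverse).mono fun h hh => ?_
    rw [← hBθ, hh, map_add, hBθ]

/-- The chain rule for tangent cones to the preimage under a submersion. -/
theorem mem_tangentCone_preimage_iff [CompleteSpace X] [FiniteDimensional ℝ Y] {f : X → Y}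
    {B : X →L[ℝ] Y} {x : X} (hf : HasStrictFDerivAt f B x) (hB : Function.Surjective B)
    {S : Set Y} {w : X} :
    w ∈ tangentCone (f ⁻¹' S) x ↔ B w ∈ tangentCone S (f x) := by
  constructor
  · rintro ⟨t, v, ht, ht0, hv, hA⟩
    have htv : Tendsto (fun i => t i • v i) atTop (𝓝 0) := by simpa using ht0.smul hv
    have hcd : Tendsto (fun i => (t i)⁻¹ • t i • v i) atTop (𝓝 w) := by
      simpa only [smul_smul, inv_mul_cancel₀ (ht _).ne', one_smul] using hv
    have hlim := (hasFDerivWithinAt_univ.2 hf.hasFDerivAt).lim htv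
      (Eventually.of_forall fun _ => Set.mem_univ _) hcd
    refine ⟨t, _, ht, ht0, hlim, fun i => ?_⟩
    rw [smul_smul, mul_inv_cancel₀ (ht i).ne', one_smul, add_sub_cancel]
    exact hA i
  · rintro ⟨t, u, ht, ht0, hu, hS⟩
    obtain ⟨φ, hφ, hφ0, hfφ⟩ := exists_straightening hf hB
    obtain ⟨R, hR⟩ := B.exists_rightInverse_of_surjective (LinearMap.range_eq_top.2 hB)
    have hBR : ∀ y, B (R y) = y := fun y => DFunLike.congr_fun hR y
    -- The vectors `w + R (u i - B w)` are lifts of `u i` through `B` that converge to `w`; `φ` then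
    -- bends them into the preimage.
    have hw : Tendsto (fun i => w + R (u i - B w)) atTop (𝓝 w) := by
      have : Tendsto (fun i => w + R (u i - B w)) atTop (𝓝 (w + R (B w - B w))) :=
        ((R.continuous.tendsto _).comp (hu.sub_const (B w))).const_add w
      simpa using this
    have htw : Tendsto (fun i => t i • (w + R (u i - B w))) atTop (𝓝 0) := by
      simpa using ht0.smul hw
    have hcd : Tendsto (fun i => (t i)⁻¹ • t i • (w + R (u i - B w))) atTop (𝓝 w) := by
      simpa only [smul_smul, inv_mul_cancel₀ (ht _).ne', one_smul] using hw
    have hlim := (hasFDerivWithinAt_univ.2 hφ.hasFDerivAt).lim htw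
      (Eventually.of_forall fun _ => Set.mem_univ _) hcd
    simp only [zero_add, hφ0, ContinuousLinearMap.id_apply] at hlim
    refine mem_tangentCone_of_eventually ht ht0 hlim
      ((htw.eventually hfφ).mono fun i hi => ?_)
    rw [smul_smul, mul_inv_cancel₀ (ht i).ne', one_smul, add_sub_cancel, Set.mem_preimage, hi,
      map_smul, map_add, hBR, add_sub_cancel]
    exact hS i

/-- A submersion has a continuous local right inverse. -/
lemma exists_local_rightInverse [CompleteSpace X] [FiniteDimensional ℝ Y] {f : X → Y}
    {B : X →L[ℝ] Y} {x : X} (hf : HasStrictFDerivAt f B x) (hB : Function.Surjective B) :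
    ∃ ψ : Y → X, Tendsto ψ (𝓝 (f x)) (𝓝 x) ∧ ∀ᶠ y in 𝓝 (f x), f (ψ y) = y := by
  obtain ⟨φ, hφ, hφ0, hfφ⟩ := exists_straightening hf hB
  obtain ⟨R, hR⟩ := B.exists_rightInverse_of_surjective (LinearMap.range_eq_top.2 hB)
  have hBR : ∀ y, B (R y) = y := fun y => DFunLike.congr_fun hR y
  have h1 : Tendsto (fun y => R (y - f x)) (𝓝 (f x)) (𝓝 0) :=
    Continuous.tendsto' (by fun_prop) _ _ (by simp)
  refine ⟨fun y => φ (R (y - f x)), ?_, (h1.eventually hfφ).mono fun y hy => ?_⟩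
  · have := hφ.hasFDerivAt.continuousAt.tendsto
    rw [hφ0] at this
    exact this.comp h1
  · rw [hy, hBR, add_sub_cancel]

/-- Operators close to a surjective operator `B` factor through `B` by isomorphisms close to the
identity. -/
lemma exists_factorization [CompleteSpace X] [FiniteDimensional ℝ Y] {B : X →L[ℝ] Y}
    (hB : Function.Surjective B) :
    ∃ C C' : (X →L[ℝ] Y) → (X →L[ℝ] X), Tendsto C (𝓝 B) (𝓝 1) ∧ Tendsto C' (𝓝 B) (𝓝 1) ∧
      ∀ᶠ B' in 𝓝 B, (∀ x, B (C B' x) = B' x) ∧ ∀ x, B' (C' B' x) = B x := by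
  obtain ⟨R, hR⟩ := B.exists_rightInverse_of_surjective (LinearMap.range_eq_top.2 hB)
  have hBR : ∀ y, B (R y) = y := fun y => DFunLike.congr_fun hR y
  -- Since `B ∘ R` is the identity, `B ∘ C B' = B'`. For `B'` near `B` the operator `C B'` is
  -- invertible, and its inverse serves as `C'`.
  let C : (X →L[ℝ] Y) → (X →L[ℝ] X) := fun B' => 1 + R.comp (B' - B)
  have hC : Tendsto C (𝓝 B) (𝓝 1) := by
    have : Continuous C := by fun_prop
    exact this.tendsto' _ _ (by simp [C])
  have hBC : ∀ B' x, B (C B' x) = B' x := fun B' x => by simp [C, hBR]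
  refine ⟨C, fun B' => Ring.inverse (C B'), hC, ?_, ?_⟩
  · have := (NormedRing.inverse_continuousAt (1 : (X →L[ℝ] X)ˣ)).tendsto
    simp only [Units.val_one, Ring.inverse_one] at this
    exact this.comp hC
  · have hu : ∀ᶠ B' in 𝓝 B, IsUnit (C B') :=
      hC.eventually (Units.nhds (1 : (X →L[ℝ] X)ˣ))
    refine hu.mono fun B' hB' => ⟨hBC B', fun x => ?_⟩
    rw [← hBC]
    exact congrArg B (DFunLike.congr_fun (Ring.mul_inverse_cancel _ hB') x)

lemma eventually_surjective [CompleteSpace X] [FiniteDimensional ℝ Y] {B : X →L[ℝ] Y}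
    (hB : Function.Surjective B) : ∀ᶠ B' : X →L[ℝ] Y in 𝓝 B, Function.Surjective B' := by
  obtain ⟨C, C', -, -, h⟩ := exists_factorization hB
  filter_upwards [h] with B' hB' y
  obtain ⟨x, rfl⟩ := hB y
  exact ⟨_, hB'.2 x⟩

lemma polar_submodule (L : Submodule ℝ X) : polar (L : Set X) = Lᗮ := by
  ext v
  rw [SetLike.mem_coe, Submodule.mem_orthogonal']
  refine ⟨fun h w hw => le_antisymm (h w hw) ?_, fun h w hw => (h w hw).le⟩
  have := h (-w) (L.neg_mem hw)
  rw [inner_neg_right] at this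
  linarith

lemma orth_submodule (L : Submodule ℝ X) : orth (L : Set X) = Lᗮ := by
  ext v
  rw [SetLike.mem_coe, Submodule.mem_orthogonal']
  rfl

lemma mem_normalCone_submodule_iff {L : Submodule ℝ X} {x v : X} :
    v ∈ normalCone (L : Set X) x ↔ x ∈ L ∧ v ∈ Lᗮ := by
  refine and_congr_right fun hx => ?_
  rw [← SetLike.mem_coe, ← polar_submodule]
  refine ⟨fun h w hw => ?_, fun h w hw => h _ (L.sub_mem hw hx)⟩
  simpa using h (x + w) (L.add_mem hx hw)

end TangentCones

/-! ### Perturbation of subspaces in the projection metric. -/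

section Subspaces

variable {X Y : Type*} [NormedAddCommGroup X] [InnerProductSpace ℝ X] [FiniteDimensional ℝ X]
  [NormedAddCommGroup Y] [InnerProductSpace ℝ Y]

/-- For `y ∈ L` the vector `C y` is fixed by the projection onto `L'`, so the component of `y`
orthogonal to `L'` is that of `(1 - C) y`. -/
lemma norm_one_sub_starProjection_mul_le {L L' : Submodule ℝ X} {C : X →L[ℝ] X}
    (hC : ∀ x ∈ L, C x ∈ L') :
    ‖(1 - L'.starProjection) * L.starProjection‖ ≤ ‖1 - C‖ := by
  refine ContinuousLinearMap.opNorm_le_bound _ (norm_nonneg _) fun x => ?_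
  set y := L.starProjection x with hy
  have hyC : L'.starProjection (C y) = C y :=
    Submodule.starProjection_eq_self_iff.2 (hC _ (L.starProjection_apply_mem x))
  have h1 : ((1 - L'.starProjection) * L.starProjection) x = L'ᗮ.starProjection ((1 - C) y) := by
    rw [Submodule.starProjection_orthogonal']
    simp [← hy, hyC]
  rw [h1]
  calc ‖L'ᗮ.starProjection ((1 - C) y)‖ ≤ ‖(1 - C) y‖ := L'ᗮ.norm_starProjection_apply_le _
    _ ≤ ‖1 - C‖ * ‖y‖ := (1 - C).le_opNorm y
    _ ≤ ‖1 - C‖ * ‖x‖ := by gcongr; exact L.norm_starProjection_apply_le x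

lemma norm_starProjection_sub_le {L L' : Submodule ℝ X} {C C' : X →L[ℝ] X}
    (hC : ∀ x ∈ L', C x ∈ L) (hC' : ∀ x ∈ L, C' x ∈ L') :
    ‖L'.starProjection - L.starProjection‖ ≤ ‖1 - C‖ + ‖1 - C'‖ := by
  set P := L.starProjection
  set P' := L'.starProjection
  -- Both terms are one-sided gaps controlled by the previous lemma, the first after taking
  -- adjoints.
  have h1 : P' - P = star ((1 - P) * P') - (1 - P') * P := by
    rw [star_mul, star_sub, star_one, (isSelfAdjoint_starProjection L).star_eq,
      (isSelfAdjoint_starProjection L').star_eq]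
    noncomm_ring
  rw [h1]
  refine (norm_sub_le _ _).trans (add_le_add ?_ (norm_one_sub_starProjection_mul_le hC'))
  refine (ContinuousLinearMap.adjoint.norm_map _).trans_le ?_
  exact norm_one_sub_starProjection_mul_le hC

/-- Preimages of subspaces under a surjective operator depend continuously on the operator,
uniformly over the subspaces. -/
lemma exists_norm_starProjection_comap_sub_le [FiniteDimensional ℝ Y] {B : X →L[ℝ] Y}
    (hB : Function.Surjective B) :
    ∃ ρ : (X →L[ℝ] Y) → ℝ, Tendsto ρ (𝓝 B) (𝓝 0) ∧ ∀ᶠ B' in 𝓝 B, ∀ V : Submodule ℝ Y,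
      ‖(V.comap B'.toLinearMap).starProjection - (V.comap B.toLinearMap).starProjection‖ ≤
        ρ B' := by
  obtain ⟨C, C', hC, hC', h⟩ := exists_factorization hB
  refine ⟨fun B' => ‖1 - C B'‖ + ‖1 - C' B'‖, ?_, h.mono fun B' hB' V => ?_⟩
  · simpa using (hC.const_sub 1).norm.add (hC'.const_sub 1).norm
  · refine norm_starProjection_sub_le (fun x hx => ?_) fun x hx => ?_
    · simpa [hB'.1] using hx
    · simpa [hB'.2] using hx

end Subspaces

/-! ### Duality between the SC derivative and the SC coderivative. -/

section Maps

variable {E G : Type*} [NormedAddCommGroup E] [InnerProductSpace ℝ E]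
  [NormedAddCommGroup G] [InnerProductSpace ℝ G]

/-- The rotation `(y*, x*) ↦ (x*, -y*)`. -/
noncomputable def prodRotation : WithLp 2 (G × E) ≃ₗᵢ[ℝ] WithLp 2 (E × G) where
  toFun q := WithLp.toLp 2 (q.snd, -q.fst)
  invFun z := WithLp.toLp 2 (-z.snd, z.fst)
  map_add' q r := WithLp.ofLp_injective 2 (Prod.ext (by simp) (by simp [add_comm]))
  map_smul' c q := WithLp.ofLp_injective 2 (Prod.ext (by simp) (by simp))
  left_inv q := WithLp.ofLp_injective 2 (Prod.ext (by simp) (by simp))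
  right_inv z := WithLp.ofLp_injective 2 (Prod.ext (by simp) (by simp))
  norm_map' q := by
    rw [WithLp.prod_norm_eq_of_L2, WithLp.prod_norm_eq_of_L2]
    simp [add_comm]

variable [FiniteDimensional ℝ E] [FiniteDimensional ℝ G]

/-- Passing to complements only changes the sign of a difference of projections, and an isometry
preserves its norm. Convergence of tangent subspaces thus transfers to the coderivative graphs. -/
lemma norm_starProjection_map_sub_le {X X' : Type*} [NormedAddCommGroup X] [InnerProductSpace ℝ X]
    [FiniteDimensional ℝ X] [NormedAddCommGroup X'] [InnerProductSpace ℝ X']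
    [FiniteDimensional ℝ X'] (J : X ≃ₗᵢ[ℝ] X') (L M : Submodule ℝ X) :
    ‖(Lᗮ.map (J.toLinearEquiv : X →ₗ[ℝ] X')).starProjection -
      (Mᗮ.map (J.toLinearEquiv : X →ₗ[ℝ] X')).starProjection‖ ≤
      ‖L.starProjection - M.starProjection‖ := by
  refine ContinuousLinearMap.opNorm_le_bound _ (norm_nonneg _) fun x => ?_
  rw [sub_apply, Submodule.starProjection_map_apply,
    Submodule.starProjection_map_apply, ← map_sub, LinearIsometryEquiv.norm_map,
    Submodule.starProjection_orthogonal', Submodule.starProjection_orthogonal']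
  have : (1 - L.starProjection) (J.symm x) - (1 - M.starProjection) (J.symm x) =
      -((L.starProjection - M.starProjection) (J.symm x)) := by
    simp
  rw [this, norm_neg, ← J.symm.norm_map x]
  exact ContinuousLinearMap.le_opNorm _ _

lemma finrank_withLp_prod :
    Module.finrank ℝ (WithLp 2 (E × G)) = Module.finrank ℝ E + Module.finrank ℝ G := by
  rw [(WithLp.linearEquiv 2 ℝ (E × G)).finrank_eq, Module.finrank_prod]

/-- A mapping with a nonempty SC derivative at a point has the SCD property there. -/
theorem hasSCDPropertyAt_of_nonempty {F : E → Set G} {z : WithLp 2 (E × G)}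
    (h : (scDerivative F z).Nonempty) : HasSCDPropertyAt F z := by
  obtain ⟨L, hL, p, M, hp, hpz, hM, hML⟩ := h
  let J : WithLp 2 (E × G) ≃ₗᵢ[ℝ] WithLp 2 (G × E) := prodRotation.symm
  refine ⟨Lᗮ.map (J.toLinearEquiv : WithLp 2 (E × G) →ₗ[ℝ] WithLp 2 (G × E)), ?_, p,
    fun i => (M i)ᗮ.map (J.toLinearEquiv : WithLp 2 (E × G) →ₗ[ℝ] WithLp 2 (G × E)), hp, hpz,
    fun i => ?_, ?_⟩
  · rw [LinearEquiv.finrank_map_eq]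
    have h1 := L.finrank_add_finrank_orthogonal
    rw [finrank_withLp_prod] at h1
    omega
  · ext q
    have : q ∈ gphRegularCoderivative F (p i) ↔ prodRotation q ∈ (M i)ᗮ := by
      rw [← SetLike.mem_coe, ← polar_submodule, hM]
      rfl
    rw [this, SetLike.mem_coe, Submodule.mem_map]
    constructor
    · rintro ⟨x, hx, rfl⟩
      change prodRotation (prodRotation.symm x) ∈ _
      simpa using hx
    · intro hq
      exact ⟨_, hq, prodRotation.symm_apply_apply q⟩
  · exact squeeze_zero (fun _ => norm_nonneg _)
      (fun i => norm_starProjection_map_sub_le J (M i) L) hML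

end Maps

/-! ### Radial sets and semismoothness* of their preimages. -/

section Radial

variable {Y : Type*} [NormedAddCommGroup Y] [InnerProductSpace ℝ Y]

/-- A set that locally is a translated cone is radial. -/
lemma eventually_radial {S C : Set Y} {c : Y} (hC : ∀ t : ℝ, 0 < t → ∀ w ∈ C, t • w ∈ C)
    (h : ∀ᶠ e in 𝓝 (0 : Y), c + e ∈ S ↔ e ∈ C) :
    ∀ᶠ e in 𝓝 (0 : Y), c + e ∈ S →
      e ∈ tangentCone S (c + e) ∧ -e ∈ tangentCone S (c + e) := by
  filter_upwards [h, h.eventually_nhds] with e he he' hS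
  -- Moving from `e` along `s • e` gives `(1 + t * s) • e`, a positive multiple of `e` for small
  -- `t`, whatever the sign of `s`.
  have key : ∀ s : ℝ, s • e ∈ tangentCone S (c + e) := by
    intro s
    have h1 : Tendsto (fun t : ℝ => e + t • s • e) (𝓝[>] 0) (𝓝 e) := by
      have : Tendsto (fun t : ℝ => e + t • s • e) (𝓝 0) (𝓝 e) :=
        Continuous.tendsto' (by fun_prop) _ _ (by simp)
      exact this.mono_left nhdsWithin_le_nhds
    have h2 : ∀ᶠ t : ℝ in 𝓝[>] 0, 0 < 1 + t * s := by
      have : Tendsto (fun t : ℝ => 1 + t * s) (𝓝 0) (𝓝 1) :=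
        Continuous.tendsto' (by fun_prop) _ _ (by simp)
      exact nhdsWithin_le_nhds (this.eventually (lt_mem_nhds one_pos))
    refine mem_tangentCone_of_eventually_nhdsGT ?_
    filter_upwards [h1.eventually he', h2] with t ht ht'
    rw [add_assoc, ht]
    have := hC _ ht' e (he.1 hS)
    rwa [add_smul, one_smul, mul_smul] at this
  exact ⟨by simpa using key 1, by simpa using key (-1)⟩

end Radial

section Semismooth

variable {X Y : Type*} [NormedAddCommGroup X] [InnerProductSpace ℝ X] [CompleteSpace X]
  [NormedAddCommGroup Y] [InnerProductSpace ℝ Y] [FiniteDimensional ℝ Y]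

/-- The preimage under a `C¹` submersion of a set that is radial, in the sense that the directions
`± e` are tangent at nearby points `f x + e`, is semismooth*. -/
lemma semismoothStarSetAt_preimage {f : X → Y} (hf : ContDiff ℝ 1 f) {x : X}
    (hB : Function.Surjective (fderiv ℝ f x)) {S : Set Y}
    (hS : ∀ᶠ e in 𝓝 (0 : Y), f x + e ∈ S →
      e ∈ tangentCone S (f x + e) ∧ -e ∈ tangentCone S (f x + e)) :
    SemismoothStarSetAt (f ⁻¹' S) x := by
  intro ε hε
  obtain ⟨R, hR⟩ :=
    (fderiv ℝ f x).exists_rightInverse_of_surjective (LinearMap.range_eq_top.2 hB)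
  have hBR : ∀ y, fderiv ℝ f x (R y) = y := fun y => DFunLike.congr_fun hR y
  obtain ⟨C, C', -, hC', hfac⟩ := exists_factorization hB
  have hstrict : ∀ y, HasStrictFDerivAt f (fderiv ℝ f y) y := fun y =>
    hf.hasStrictFDerivAt one_ne_zero
  have hcont : Tendsto (fderiv ℝ f) (𝓝 x) (𝓝 (fderiv ℝ f x)) :=
    (contDiff_one_iff_fderiv.1 hf).2.tendsto x
  -- The factor `4` pays for `‖C'‖ ≤ 2` and for the two errors of size `η * ‖x' - x‖` in `o`; `‖R‖ +
  -- 1` pays for the lift `R` and keeps the denominator positive.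
  set η := ε / (4 * (‖R‖ + 1)) with hη
  have hη0 : 0 < η := by positivity
  have hsub : Tendsto (fun x' => f x' - f x) (𝓝 x) (𝓝 0) := by
    have : Continuous fun x' => f x' - f x := hf.continuous.sub continuous_const
    exact this.tendsto' _ _ (sub_self _)
  have hC2 : ∀ᶠ B' in 𝓝 (fderiv ℝ f x), ‖C' B'‖ ≤ 2 := by
    have h1 : ‖(1 : X →L[ℝ] X)‖ < 2 :=
      ContinuousLinearMap.norm_id_le.trans_lt one_lt_two
    exact (hC'.norm.eventually (gt_mem_nhds h1)).mono fun _ h => h.le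
  have hnear : ∀ᶠ B' in 𝓝 (fderiv ℝ f x), ‖B' - fderiv ℝ f x‖ ≤ η :=
    Filter.mem_of_superset (Metric.closedBall_mem_nhds _ hη0) fun B' h => by
      simpa [dist_eq_norm] using h
  have hall : ∀ᶠ x' in 𝓝 x, x' ∈ f ⁻¹' S → ∀ n ∈ regularNormalCone (f ⁻¹' S) x',
      |inner ℝ n (x' - x)| ≤ ε * ‖x' - x‖ * ‖n‖ := by
    filter_upwards [hcont.eventually hfac, hcont.eventually (eventually_surjective hB),
      hsub.eventually hS, hcont.eventually hC2, hcont.eventually hnear,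
      (hstrict x).hasFDerivAt.isLittleO.def hη0] with x' h1 h2 h3 h4 h5 h6 hx' n hn
    rw [add_sub_cancel] at h3
    -- The linearization error `o` is lifted to a correction `h` for which the derivative at `x'`
    -- sends `x' - x + h` exactly to `f x' - f x`. Then `±(x' - x + h)` are tangent, so a normal `n`
    -- is orthogonal to `x' - x + h`, and only the small `h` contributes to `inner ℝ n (x' - x)`.
    set o := f x' - f x - fderiv ℝ f x' (x' - x) with ho
    set h := C' (fderiv ℝ f x') (R o) with hh
    have hw : fderiv ℝ f x' (x' - x + h) = f x' - f x := by
      rw [map_add, hh, h1.2, hBR, ho, add_sub_cancel]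
    have hp : inner ℝ n (x' - x + h) ≤ 0 :=
      hn _ ((mem_tangentCone_preimage_iff (hstrict x') h2).2 (by rw [hw]; exact (h3 hx').1))
    have hm : inner ℝ n (-(x' - x + h)) ≤ 0 :=
      hn _ ((mem_tangentCone_preimage_iff (hstrict x') h2).2
        (by rw [map_neg, hw]; exact (h3 hx').2))
    rw [inner_neg_right] at hm
    have hinner : inner ℝ n (x' - x) = -inner ℝ n h := by
      have : inner ℝ n (x' - x + h) = 0 := by linarith
      rw [inner_add_right] at this
      linarith
    have ho' : ‖o‖ ≤ 2 * η * ‖x' - x‖ := by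
      have : o = (f x' - f x - fderiv ℝ f x (x' - x)) -
          (fderiv ℝ f x' - fderiv ℝ f x) (x' - x) := by
        rw [ho, sub_apply]; abel
      rw [this]
      calc _ ≤ η * ‖x' - x‖ + η * ‖x' - x‖ := (norm_sub_le _ _).trans (add_le_add h6
            ((ContinuousLinearMap.le_opNorm _ _).trans (by gcongr)))
        _ = _ := by ring
    have hh' : ‖h‖ ≤ ε * ‖x' - x‖ := by
      calc ‖h‖ ≤ ‖C' (fderiv ℝ f x')‖ * ‖R o‖ := ContinuousLinearMap.le_opNorm _ _
        _ ≤ 2 * (‖R‖ * (2 * η * ‖x' - x‖)) := by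
            gcongr
            exact (R.le_opNorm o).trans (by gcongr)
        _ = (4 * ‖R‖ * η) * ‖x' - x‖ := by ring
        _ ≤ (4 * (‖R‖ + 1) * η) * ‖x' - x‖ := by gcongr; linarith
        _ = ε * ‖x' - x‖ := by rw [hη]; field_simp
    rw [hinner, abs_neg]
    calc |inner ℝ n h| ≤ ‖n‖ * ‖h‖ := abs_real_inner_le_norm n h
      _ ≤ ‖n‖ * (ε * ‖x' - x‖) := by gcongr
      _ = _ := by ring
  obtain ⟨δ, hδ, hball⟩ := Metric.nhds_basis_closedBall.eventually_iff.1 hall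
  exact ⟨δ, hδ, fun x' hx' => hball hx'.2 hx'.1⟩

end Semismooth

/-! ### The map `(q, d*) ↦ (g q, d*)` and normal graphs of subspaces. -/

section Composition

variable {E G : Type*} [NormedAddCommGroup E] [InnerProductSpace ℝ E]
  [NormedAddCommGroup G] [InnerProductSpace ℝ G]

/-- The map `(q, d*) ↦ (g q, d*)`. -/
noncomputable def graphMap (g : E → G) (z : WithLp 2 (E × G)) : WithLp 2 (G × G) :=
  WithLp.toLp 2 (g z.fst, z.snd)

lemma contDiff_graphMap {g : E → G} (hg : ContDiff ℝ 1 g) : ContDiff ℝ 1 (graphMap g) := by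
  have h1 : ContDiff ℝ 1 fun z : WithLp 2 (E × G) => z.fst := (WithLp.fstL 2 ℝ E G).contDiff
  have h2 : ContDiff ℝ 1 fun z : WithLp 2 (E × G) => z.snd := (WithLp.sndL 2 ℝ E G).contDiff
  exact (WithLp.prodContinuousLinearEquiv 2 ℝ G G).symm.contDiff.comp
    ((hg.comp h1).prodMk h2)

lemma fderiv_graphMap_apply {g : E → G} (hg : ContDiff ℝ 1 g) (z w : WithLp 2 (E × G)) :
    fderiv ℝ (graphMap g) z w = WithLp.toLp 2 (fderiv ℝ g z.fst w.fst, w.snd) := by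
  have h1 : HasFDerivAt (fun z : WithLp 2 (E × G) => z.fst) (WithLp.fstL 2 ℝ E G) z :=
    (WithLp.fstL 2 ℝ E G).hasFDerivAt
  have h2 : HasFDerivAt (fun z : WithLp 2 (E × G) => z.snd) (WithLp.sndL 2 ℝ E G) z :=
    (WithLp.sndL 2 ℝ E G).hasFDerivAt
  have h3 : HasFDerivAt g (fderiv ℝ g z.fst) z.fst :=
    ((contDiff_one_iff_fderiv.1 hg).1 _).hasFDerivAt
  have h4 := (WithLp.prodContinuousLinearEquiv 2 ℝ G G).symm.hasFDerivAt.comp z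
    ((h3.comp z h1).prodMk h2)
  have h5 : HasFDerivAt (graphMap g) _ z := h4
  rw [h5.fderiv]
  rfl

lemma surjective_fderiv_graphMap {g : E → G} (hg : ContDiff ℝ 1 g) {z : WithLp 2 (E × G)}
    (h : Function.Surjective (fderiv ℝ g z.fst)) :
    Function.Surjective (fderiv ℝ (graphMap g) z) := by
  intro y
  obtain ⟨u, hu⟩ := h y.fst
  refine ⟨WithLp.toLp 2 (u, y.snd), ?_⟩
  rw [fderiv_graphMap_apply hg]
  exact congrArg (WithLp.toLp 2) (Prod.ext hu rfl)

/-- The graph of the normal cone mapping of a subspace. -/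
noncomputable def normalGraph (L : Submodule ℝ G) : Submodule ℝ (WithLp 2 (G × G)) :=
  L.comap (WithLp.fstL 2 ℝ G G).toLinearMap ⊓ Lᗮ.comap (WithLp.sndL 2 ℝ G G).toLinearMap

lemma coe_normalGraph (L : Submodule ℝ G) :
    (normalGraph L : Set (WithLp 2 (G × G))) = gph (normalCone (L : Set G)) := by
  ext w
  exact (mem_normalCone_submodule_iff (L := L) (x := w.fst) (v := w.snd)).symm

variable [FiniteDimensional ℝ E] [FiniteDimensional ℝ G]

/-- The subspace `normalGraph L` is the kernel of the surjection `(x, y) ↦ P_{Lᗮ} x + P_L y` onto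
`G`. Composing with `B` and using rank-nullity on `E × G` leaves dimension `dim E`, independently of
`L`. -/
lemma finrank_comap_normalGraph (L : Submodule ℝ G)
    {B : WithLp 2 (E × G) →L[ℝ] WithLp 2 (G × G)} (hB : Function.Surjective B) :
    Module.finrank ℝ ((normalGraph L).comap B.toLinearMap) = Module.finrank ℝ E := by
  let T : WithLp 2 (G × G) →L[ℝ] G := Lᗮ.starProjection.comp (WithLp.fstL 2 ℝ G G) +
    L.starProjection.comp (WithLp.sndL 2 ℝ G G)
  have hT : ∀ y, T y = Lᗮ.starProjection y.fst + L.starProjection y.snd := fun _ => rfl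
  have hker : (normalGraph L).comap B.toLinearMap = (T.comp B).toLinearMap.ker := by
    ext w
    have : w ∈ (T.comp B).toLinearMap.ker ↔ T (B w) = 0 := Iff.rfl
    rw [this, hT]
    change (B w).fst ∈ L ∧ (B w).snd ∈ Lᗮ ↔ _
    constructor
    · rintro ⟨h1, h2⟩
      rw [(Lᗮ.starProjection_apply_eq_zero_iff).2 (by simpa using h1),
        L.starProjection_apply_eq_zero_iff.2 h2, add_zero]
    · intro h
      have h1 := Lᗮ.starProjection_apply_mem (B w).fst
      have h2 := L.starProjection_apply_mem (B w).snd
      have h3 : L.starProjection (B w).snd = 0 := by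
        have h4 : L.starProjection (B w).snd ∈ Lᗮ := by
          rw [eq_neg_of_add_eq_zero_right h]
          exact Lᗮ.neg_mem h1
        exact inner_self_eq_zero.1 (h4 _ h2)
      rw [h3, add_zero, Lᗮ.starProjection_apply_eq_zero_iff, L.orthogonal_orthogonal] at h
      exact ⟨h, L.starProjection_apply_eq_zero_iff.1 h3⟩
  have hsurj : Function.Surjective (T.comp B) := by
    intro y
    obtain ⟨w, hw⟩ := hB (WithLp.toLp 2 (y, y))
    refine ⟨w, ?_⟩
    rw [ContinuousLinearMap.comp_apply, hw, hT]
    change Lᗮ.starProjection y + L.starProjection y = y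
    rw [add_comm]
    exact L.starProjection_add_starProjection_orthogonal y
  have h1 := (T.comp B).toLinearMap.finrank_range_add_finrank_ker
  rw [LinearMap.range_eq_top.2 hsurj, finrank_top, finrank_withLp_prod] at h1
  rw [hker]
  omega

end Composition

section Continuity

variable {E G : Type*} [NormedAddCommGroup E] [InnerProductSpace ℝ E]
  [NormedAddCommGroup G] [InnerProductSpace ℝ G] {g : E → G}

lemma isFace_self {K : Set G} (hK : IsPolyhedralCone K) : IsFace K K :=
  ⟨⟨0, hK.zero_mem⟩, hK.convex, IsExtreme.rfl⟩

lemma tendsto_apply_of_tendsto {X Y : Type*} [NormedAddCommGroup X] [NormedSpace ℝ X]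
    [NormedAddCommGroup Y] [NormedSpace ℝ Y] {A : ℕ → X →L[ℝ] Y} {v : ℕ → X} {A₀ : X →L[ℝ] Y}
    {v₀ : X} (hA : Tendsto A atTop (𝓝 A₀)) (hv : Tendsto v atTop (𝓝 v₀)) :
    Tendsto (fun i => A i (v i)) atTop (𝓝 (A₀ v₀)) :=
  (isBoundedBilinearMap_apply.continuous.tendsto (A₀, v₀)).comp (hA.prodMk_nhds hv)

lemma tendsto_graphMap_sub (hg : ContDiff ℝ 1 g) (z : WithLp 2 (E × G)) :
    Tendsto (fun z' => graphMap g z' - graphMap g z) (𝓝 z) (𝓝 0) := by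
  have : Continuous fun z' => graphMap g z' - graphMap g z :=
    (contDiff_graphMap hg).continuous.sub continuous_const
  exact this.tendsto' _ _ (sub_self _)

lemma tendsto_fderiv_graphMap (hg : ContDiff ℝ 1 g) (z : WithLp 2 (E × G)) :
    Tendsto (fderiv ℝ (graphMap g)) (𝓝 z) (𝓝 (fderiv ℝ (graphMap g) z)) :=
  (contDiff_one_iff_fderiv.1 (contDiff_graphMap hg)).2.tendsto z

end Continuity

/-! ### Tangent cones to the two graphs near the reference point. -/

section NormalConeGraph

variable {G : Type*} [NormedAddCommGroup G] [InnerProductSpace ℝ G] [FiniteDimensional ℝ G]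

/-- The difference is itself a critical cone of `K`, hence polyhedral. This makes the graph of its
normal cone mapping closed. -/
lemma IsPolyhedralCone.face_sub_face {K F₁ F₂ : Set G} (hK : IsPolyhedralCone K)
    (hF₁ : IsFace K F₁) (hF₂ : IsFace K F₂) (h : F₂ ⊆ F₁) : IsPolyhedralCone (F₁ - F₂) := by
  obtain ⟨v, vs, hv⟩ := hK.exists_criticalCone_eq_sub hF₁ hF₂ h
  obtain ⟨h1, h2⟩ := hv 1 one_pos
  rw [← h2]
  exact hK.isConvexPolyhedral.isPolyhedralCone_criticalCone h1.1

/-- Tangent cones to the graph of the normal cone mapping at points near a reference point. -/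
lemma IsConvexPolyhedral.eventually_tangentCone_gph_normalCone {D : Set G}
    (hD : IsConvexPolyhedral D) {d ds : G} (h : ds ∈ normalCone D d) :
    ∀ᶠ e in 𝓝 (0 : WithLp 2 (G × G)),
      (WithLp.toLp 2 (d, ds) + e ∈ gph (normalCone D) ↔
        e ∈ gph (normalCone (criticalCone D d ds))) ∧
      (e ∈ gph (normalCone (criticalCone D d ds)) →
        tangentCone (gph (normalCone D)) (WithLp.toLp 2 (d, ds) + e) =
          gph (normalCone (criticalCone (criticalCone D d ds) e.fst e.snd))) := by
  have hK := hD.isPolyhedralCone_criticalCone (ds := ds) h.1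
  have hloc := hD.eventually_add_mem_gph_normalCone_iff h
  filter_upwards [hloc, hloc.eventually_nhds] with e he he'
  refine ⟨he, fun heK => ?_⟩
  rw [← hK.isConvexPolyhedral.tangentCone_gph_normalCone (d := e.fst) (ds := e.snd) heK]
  refine tangentCone_congr ?_
  have h1 : Tendsto (fun a => e + a) (𝓝 0) (𝓝 e) :=
    Continuous.tendsto' (by fun_prop) _ _ (add_zero e)
  refine (h1.eventually he').mono fun a ha => ?_
  rw [add_assoc, ha]
  rfl

end NormalConeGraph

/-! ### Limits of tangent cones to the graph of the composite mapping. -/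

section Composite

variable {E G : Type*} [NormedAddCommGroup E] [InnerProductSpace ℝ E] [FiniteDimensional ℝ E]
  [NormedAddCommGroup G] [InnerProductSpace ℝ G] [FiniteDimensional ℝ G]
  {D : Set G} {g : E → G} {p : E} {ds : G}

lemma tangentCone_gph_comp (hg : ContDiff ℝ 1 g) {z : WithLp 2 (E × G)}
    (hz : Function.Surjective (fderiv ℝ (graphMap g) z)) :
    tangentCone (gph fun q => normalCone D (g q)) z =
      fderiv ℝ (graphMap g) z ⁻¹' tangentCone (gph (normalCone D)) (graphMap g z) := by
  ext w
  exact mem_tangentCone_preimage_iff (S := gph (normalCone D))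
    ((contDiff_graphMap hg).hasStrictFDerivAt one_ne_zero) hz

/-- Near the reference point, tangent cones to the graph of `q ↦ N_D (g q)` are preimages of the
graphs of normal cone mappings to differences of faces of the critical cone. -/
lemma eventually_exists_faces (hD : IsConvexPolyhedral D) (hg : ContDiff ℝ 1 g)
    (hsurj : Function.Surjective (fderiv ℝ g p)) (hds : ds ∈ normalCone D (g p)) :
    ∀ᶠ z in 𝓝 (WithLp.toLp 2 (p, ds)), z ∈ gph (fun q => normalCone D (g q)) →
      ∃ F₁ F₂, IsFace (criticalCone D (g p) ds) F₁ ∧ IsFace (criticalCone D (g p) ds) F₂ ∧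
        F₂ ⊆ F₁ ∧ tangentCone (gph fun q => normalCone D (g q)) z =
          fderiv ℝ (graphMap g) z ⁻¹' gph (normalCone (F₁ - F₂)) := by
  have hK := hD.isPolyhedralCone_criticalCone (ds := ds) hds.1
  filter_upwards [(tendsto_graphMap_sub hg _).eventually
      (hD.eventually_tangentCone_gph_normalCone hds),
    (tendsto_fderiv_graphMap hg _).eventually (eventually_surjective
      (surjective_fderiv_graphMap hg (z := WithLp.toLp 2 (p, ds)) hsurj))] with z h1 h2 hz
  set e := graphMap g z - graphMap g (WithLp.toLp 2 (p, ds)) with he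
  have hadd : WithLp.toLp 2 (g p, ds) + e = graphMap g z := add_sub_cancel _ _
  rw [hadd] at h1
  have heK : e.snd ∈ normalCone (criticalCone D (g p) ds) e.fst := h1.1.1 hz
  refine ⟨_, _, hK.isFace_inter_orth (hK.mem_normalCone_iff.1 heK).2.1,
    hK.isFace_minimalFace heK.1, hK.minimalFace_subset_inter_orth heK, ?_⟩
  rw [tangentCone_gph_comp hg h2, h1.2 heK, hK.criticalCone_eq_sub heK]

/-- Every pair of nested faces of the critical cone arises from points of the graph arbitrarily
close to the reference point. -/
lemma exists_seq_tangentCone_eq (hD : IsConvexPolyhedral D) (hg : ContDiff ℝ 1 g)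
    (hsurj : Function.Surjective (fderiv ℝ g p)) (hds : ds ∈ normalCone D (g p))
    {F₁ F₂ : Set G} (hF₁ : IsFace (criticalCone D (g p) ds) F₁)
    (hF₂ : IsFace (criticalCone D (g p) ds) F₂) (hF : F₂ ⊆ F₁)
    {P : WithLp 2 (E × G) → Prop} (hP : ∀ᶠ z in 𝓝 (WithLp.toLp 2 (p, ds)), P z) :
    ∃ z : ℕ → WithLp 2 (E × G), Tendsto z atTop (𝓝 (WithLp.toLp 2 (p, ds))) ∧
      ∀ i, P (z i) ∧ z i ∈ gph (fun q => normalCone D (g q)) ∧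
        tangentCone (gph fun q => normalCone D (g q)) (z i) =
          fderiv ℝ (graphMap g) (z i) ⁻¹' gph (normalCone (F₁ - F₂)) := by
  have hK := hD.isPolyhedralCone_criticalCone (ds := ds) hds.1
  have hB := surjective_fderiv_graphMap hg (z := WithLp.toLp 2 (p, ds)) hsurj
  obtain ⟨v, vs, hv⟩ := hK.exists_criticalCone_eq_sub hF₁ hF₂ hF
  obtain ⟨ψ, hψ, hfψ⟩ := exists_local_rightInverse
    ((contDiff_graphMap hg).hasStrictFDerivAt one_ne_zero) hB
  let t : ℕ → ℝ := fun i => 1 / ((i : ℝ) + 1)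
  have ht0 : ∀ i, 0 < t i := fun i => by positivity
  -- Shrinking `(v, vs)` along its ray does not change the critical cone, so the pair of faces is
  -- realized arbitrarily close to the origin.
  let e : ℕ → WithLp 2 (G × G) := fun i => t i • WithLp.toLp 2 (v, vs)
  have he : Tendsto e atTop (𝓝 0) := by
    have := (tendsto_one_div_add_atTop_nhds_zero_nat (𝕜 := ℝ)).smul_const
      (WithLp.toLp 2 (v, vs) : WithLp 2 (G × G))
    rwa [zero_smul] at this
  have hy : Tendsto (fun i => WithLp.toLp 2 (g p, ds) + e i) atTop
      (𝓝 (graphMap g (WithLp.toLp 2 (p, ds)))) := by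
    have := he.const_add (WithLp.toLp 2 (g p, ds))
    rwa [add_zero] at this
  have hz : Tendsto (fun i => ψ (WithLp.toLp 2 (g p, ds) + e i)) atTop
      (𝓝 (WithLp.toLp 2 (p, ds))) := hψ.comp hy
  have hall : ∀ᶠ i in atTop, P (ψ (WithLp.toLp 2 (g p, ds) + e i)) ∧
      ψ (WithLp.toLp 2 (g p, ds) + e i) ∈ gph (fun q => normalCone D (g q)) ∧
        tangentCone (gph fun q => normalCone D (g q)) (ψ (WithLp.toLp 2 (g p, ds) + e i)) =
          fderiv ℝ (graphMap g) (ψ (WithLp.toLp 2 (g p, ds) + e i)) ⁻¹'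
            gph (normalCone (F₁ - F₂)) := by
    filter_upwards [hz.eventually hP, hy.eventually hfψ,
      he.eventually (hD.eventually_tangentCone_gph_normalCone hds),
      hz.eventually ((tendsto_fderiv_graphMap hg _).eventually (eventually_surjective hB))]
      with i h1 h2 h3 h4
    obtain ⟨h5, h6⟩ := hv (t i) (ht0 i)
    have heK : e i ∈ gph (normalCone (criticalCone D (g p) ds)) := h5
    refine ⟨h1, ?_, ?_⟩
    · change graphMap g _ ∈ gph (normalCone D)
      rw [h2]
      exact h3.1.2 heK
    · rw [tangentCone_gph_comp hg h4, h2, h3.2 heK, ← h6]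
      rfl
  obtain ⟨N, hN⟩ := eventually_atTop.1 hall
  exact ⟨fun i => ψ (WithLp.toLp 2 (g p, ds) + e (i + N)), hz.comp (tendsto_add_atTop_nat N),
    fun i => hN _ (by omega)⟩

/-- The elements of the SC derivative of `q ↦ N_D (g q)` are the subspaces generated by the faces
of the critical cone. -/
lemma mem_scDerivative_iff (hD : IsConvexPolyhedral D) (hg : ContDiff ℝ 1 g)
    (hsurj : Function.Surjective (fderiv ℝ g p)) (hds : ds ∈ normalCone D (g p))
    {L : Submodule ℝ (WithLp 2 (E × G))} :
    L ∈ scDerivative (fun q => normalCone D (g q)) (WithLp.toLp 2 (p, ds)) ↔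
      ∃ F, IsFace (criticalCone D (g p) ds) F ∧ L = (normalGraph (Submodule.span ℝ F)).comap
        (fderiv ℝ (graphMap g) (WithLp.toLp 2 (p, ds))).toLinearMap := by
  have hK := hD.isPolyhedralCone_criticalCone (ds := ds) hds.1
  have hB := surjective_fderiv_graphMap hg (z := WithLp.toLp 2 (p, ds)) hsurj
  obtain ⟨ρ, hρ, hρle⟩ := exists_norm_starProjection_comap_sub_le hB
  constructor
  · rintro ⟨-, z, M, hz, hzlim, hM, hML⟩
    let W : Set G → Submodule ℝ (WithLp 2 (E × G)) := fun F =>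
      (normalGraph (Submodule.span ℝ F)).comap
        (fderiv ℝ (graphMap g) (WithLp.toLp 2 (p, ds))).toLinearMap
    have hev : ∀ᶠ i in atTop, ∃ F, IsFace (criticalCone D (g p) ds) F ∧
        ‖(M i).starProjection - (W F).starProjection‖ ≤ ρ (fderiv ℝ (graphMap g) (z i)) := by
      filter_upwards [hzlim.eventually (eventually_exists_faces hD hg hsurj hds),
        hzlim.eventually ((tendsto_fderiv_graphMap hg _).eventually hρle),
        hzlim.eventually ((tendsto_fderiv_graphMap hg _).eventually (eventually_surjective hB))]
        with i h1 h2 h3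
      obtain ⟨F₁, F₂, hF₁, hF₂, hF, hT⟩ := h1 (hz i).1
      have hC := hK.face_sub_face hF₁ hF₂ hF
      have hmem : ∀ w, w ∈ M i ↔
          fderiv ℝ (graphMap g) (z i) w ∈ gph (normalCone (F₁ - F₂)) := fun w => by
        rw [← SetLike.mem_coe, hM, hT]
        rfl
      -- The image of the tangent subspace is the graph of `N_{F₁ - F₂}`; its slice at zero normal
      -- component is the domain `F₁ - F₂`, which is therefore a subspace.
      let S : Submodule ℝ G :=
        ((M i).map (fderiv ℝ (graphMap g) (z i)).toLinearMap).comap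
          ((WithLp.linearEquiv 2 ℝ (G × G)).symm.toLinearMap ∘ₗ LinearMap.inl ℝ G G)
      have hS : (S : Set G) = F₁ - F₂ := by
        ext x
        have h0 : (WithLp.toLp 2 (x, (0 : G)) : WithLp 2 (G × G)) ∈
            gph (normalCone (F₁ - F₂)) ↔ x ∈ F₁ - F₂ := by
          refine ⟨fun h => h.1, fun h => ⟨h, fun w _ => ?_⟩⟩
          change inner ℝ (0 : G) _ ≤ 0
          rw [inner_zero_left]
        rw [← h0]
        constructor
        · rintro ⟨w, hw, hwx⟩
          have hwx : fderiv ℝ (graphMap g) (z i) w = WithLp.toLp 2 (x, 0) := hwx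
          rw [← hwx]
          exact (hmem w).1 hw
        · intro h
          obtain ⟨w, hw⟩ := h3 (WithLp.toLp 2 (x, 0))
          exact ⟨w, (hmem w).2 (by rw [hw]; exact h), hw⟩
      have hMi : M i = (normalGraph (Submodule.span ℝ F₁)).comap
          (fderiv ℝ (graphMap g) (z i)).toLinearMap := by
        ext w
        rw [hmem, hK.sub_eq_sub_self hF₂ hF hS, hK.sub_self_eq_span hF₁, ← coe_normalGraph]
        rfl
      exact ⟨F₁, hF₁, by rw [hMi]; exact h2 _⟩
    have hfin : ((fun F => (W F).starProjection) ''
        {F | IsFace (criticalCone D (g p) ds) F}).Finite :=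
      hK.finite_faces.image _
    have hmem : L.starProjection ∈
        (fun F => (W F).starProjection) '' {F | IsFace (criticalCone D (g p) ds) F} := by
      -- The projections attached to faces form a finite, hence closed, set. Those of `M i` come
      -- arbitrarily close to it and converge to that of `L`.
      refine Metric.mem_of_closed' hfin.isClosed |>.2 fun ε hε => ?_
      have hρ' := hρ.comp ((tendsto_fderiv_graphMap hg _).comp hzlim)
      obtain ⟨i, ⟨F, hF, hle⟩, h1, h2⟩ := (hev.and
        ((hρ'.eventually (gt_mem_nhds (half_pos hε))).and
          (hML.eventually (gt_mem_nhds (half_pos hε))))).exists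
      refine ⟨_, ⟨F, hF, rfl⟩, ?_⟩
      rw [dist_eq_norm]
      have : L.starProjection - (W F).starProjection =
          ((M i).starProjection - (W F).starProjection) -
            ((M i).starProjection - L.starProjection) := by abel
      dsimp only
      rw [this]
      have h1 : ρ (fderiv ℝ (graphMap g) (z i)) < ε / 2 := h1
      linarith [norm_sub_le ((M i).starProjection - (W F).starProjection)
        ((M i).starProjection - L.starProjection)]
    obtain ⟨F, hF, hFL⟩ := hmem
    exact ⟨F, hF, (Submodule.starProjection_inj.1 hFL).symm⟩
  · rintro ⟨F, hF, rfl⟩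
    refine ⟨finrank_comap_normalGraph _ hB, ?_⟩
    obtain ⟨z, hz, hzi⟩ := exists_seq_tangentCone_eq hD hg hsurj hds hF hF subset_rfl
      (((tendsto_fderiv_graphMap hg _).eventually hρle).and
        ((tendsto_fderiv_graphMap hg _).eventually (eventually_surjective hB)))
    have hM : ∀ i, (((normalGraph (Submodule.span ℝ F)).comap
        (fderiv ℝ (graphMap g) (z i)).toLinearMap : Submodule ℝ _) : Set (WithLp 2 (E × G))) =
          tangentCone (gph fun q => normalCone D (g q)) (z i) := fun i => by
      rw [(hzi i).2.2, hK.sub_self_eq_span hF, ← coe_normalGraph]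
      rfl
    exact ⟨z, fun i => (normalGraph (Submodule.span ℝ F)).comap
        (fderiv ℝ (graphMap g) (z i)).toLinearMap,
      fun i => ⟨(hzi i).2.1, _, finrank_comap_normalGraph _ (hzi i).1.2, hM i⟩, hz, hM,
      squeeze_zero (fun _ => norm_nonneg _) (fun i => (hzi i).1.1 _)
        (hρ.comp ((tendsto_fderiv_graphMap hg _).comp hz))⟩

lemma outerLimitingTangentCone_gph_comp (hD : IsConvexPolyhedral D) (hg : ContDiff ℝ 1 g)
    (hsurj : Function.Surjective (fderiv ℝ g p)) (hds : ds ∈ normalCone D (g p)) :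
    outerLimitingTangentCone (gph fun q => normalCone D (g q)) (WithLp.toLp 2 (p, ds)) =
      {w | ∃ F₁ F₂, IsFace (criticalCone D (g p) ds) F₁ ∧ IsFace (criticalCone D (g p) ds) F₂ ∧
        F₂ ⊆ F₁ ∧ WithLp.toLp 2 (fderiv ℝ g p w.fst, w.snd) ∈ gph (normalCone (F₁ - F₂))} := by
  have hK := hD.isPolyhedralCone_criticalCone (ds := ds) hds.1
  have hB := surjective_fderiv_graphMap hg (z := WithLp.toLp 2 (p, ds)) hsurj
  ext w
  have happ := fderiv_graphMap_apply hg (WithLp.toLp 2 (p, ds)) w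
  change _ ↔ ∃ F₁ F₂, _ ∧ _ ∧ _ ∧ WithLp.toLp 2
    (fderiv ℝ g (WithLp.toLp 2 (p, ds) : WithLp 2 (E × G)).fst w.fst, w.snd) ∈ _
  rw [← happ]
  constructor
  · rintro ⟨z, v, hz, hzlim, hv, hvlim⟩
    let I : Set (Set G × Set G) := {F | IsFace (criticalCone D (g p) ds) F.1 ∧
      IsFace (criticalCone D (g p) ds) F.2 ∧ F.2 ⊆ F.1}
    have hI : I.Finite := (hK.finite_faces.prod hK.finite_faces).subset fun F hF =>
      ⟨hF.1, hF.2.1⟩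
    -- The pair of faces may change along the sequence, but a finite union of closed graphs retains
    -- the limit.
    have hclosed : IsClosed (⋃ F ∈ I, gph (normalCone (F.1 - F.2))) :=
      hI.isClosed_biUnion fun F hF =>
        (hK.face_sub_face hF.1 hF.2.1 hF.2.2).isClosed_gph_normalCone
    have hlim : Tendsto (fun i => fderiv ℝ (graphMap g) (z i) (v i)) atTop
        (𝓝 (fderiv ℝ (graphMap g) (WithLp.toLp 2 (p, ds)) w)) :=
      tendsto_apply_of_tendsto ((tendsto_fderiv_graphMap hg _).comp hzlim) hvlim
    have := hclosed.mem_of_tendsto hlim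
      ((hzlim.eventually (eventually_exists_faces hD hg hsurj hds)).mono fun i hi => by
        obtain ⟨F₁, F₂, h1, h2, h3, h4⟩ := hi (hz i)
        have hvi := hv i
        rw [h4] at hvi
        exact Set.mem_biUnion (x := (F₁, F₂)) ⟨h1, h2, h3⟩ hvi)
    obtain ⟨F, hF, hw⟩ := Set.mem_iUnion₂.1 this
    exact ⟨F.1, F.2, hF.1, hF.2.1, hF.2.2, hw⟩
  · rintro ⟨F₁, F₂, hF₁, hF₂, hF, hw⟩
    obtain ⟨C, C', -, hC', hfac⟩ := exists_factorization hB
    obtain ⟨z, hz, hzi⟩ := exists_seq_tangentCone_eq hD hg hsurj hds hF₁ hF₂ hF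
      ((tendsto_fderiv_graphMap hg _).eventually hfac)
    -- The derivative at `z i` sends the corrected vector to the same image as the derivative at the
    -- reference point sends `w`, so it is tangent at `z i`; it tends to `w` because `C'` tends to
    -- the identity.
    refine ⟨z, fun i => C' (fderiv ℝ (graphMap g) (z i)) w, fun i => (hzi i).2.1, hz,
      fun i => ?_, ?_⟩
    · rw [(hzi i).2.2, Set.mem_preimage, (hzi i).1.2]
      exact hw
    · have := tendsto_apply_of_tendsto (hC'.comp ((tendsto_fderiv_graphMap hg _).comp hz))
        (tendsto_const_nhds (x := w))
      simpa using this

lemma hasSCDPropertyAt_comp (hD : IsConvexPolyhedral D) (hg : ContDiff ℝ 1 g)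
    (hsurj : Function.Surjective (fderiv ℝ g p)) (hds : ds ∈ normalCone D (g p)) :
    HasSCDPropertyAt (fun q => normalCone D (g q)) (WithLp.toLp 2 (p, ds)) :=
  hasSCDPropertyAt_of_nonempty ⟨_, (mem_scDerivative_iff hD hg hsurj hds).2
    ⟨_, isFace_self (hD.isPolyhedralCone_criticalCone hds.1), rfl⟩⟩

lemma semismoothStarAt_comp (hD : IsConvexPolyhedral D) (hg : ContDiff ℝ 1 g)
    (hsurj : Function.Surjective (fderiv ℝ g p)) (hds : ds ∈ normalCone D (g p)) :
    SemismoothStarAt (fun q => normalCone D (g q)) (WithLp.toLp 2 (p, ds)) := by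
  have hK := hD.isPolyhedralCone_criticalCone (ds := ds) hds.1
  have hB := surjective_fderiv_graphMap hg (z := WithLp.toLp 2 (p, ds)) hsurj
  exact semismoothStarSetAt_preimage (S := gph (normalCone D)) (contDiff_graphMap hg) hB
    (eventually_radial (fun _ ht _ hw => hK.smul_mem_gph_normalCone ht hw)
      (hD.eventually_add_mem_gph_normalCone_iff hds))

/-- The pointwise results need only surjectivity of the derivative of `g`, so this open condition
supplies the neighborhood in both "around" properties. -/
lemma eventually_surjective_fderiv_fst (hg : ContDiff ℝ 1 g)
    (hsurj : Function.Surjective (fderiv ℝ g p)) :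
    ∀ᶠ z in 𝓝 (WithLp.toLp 2 (p, ds)), Function.Surjective (fderiv ℝ g z.fst) := by
  have h1 : Tendsto (fun z : WithLp 2 (E × G) => fderiv ℝ g z.fst) (𝓝 (WithLp.toLp 2 (p, ds)))
      (𝓝 (fderiv ℝ g p)) := by
    have : Continuous fun z : WithLp 2 (E × G) => fderiv ℝ g z.fst :=
      (contDiff_one_iff_fderiv.1 hg).2.comp (by fun_prop)
    exact this.tendsto' _ _ rfl
  exact h1.eventually (eventually_surjective hsurj)

end Composite

end VarAnal

/-! ### Assembly of the four assertions. -/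

theorem proposition5p4 (l k : ℕ)
    (D : Set (EuclideanSpace ℝ (Fin k))) (hD : VarAnal.IsConvexPolyhedral D)
    (g : WithLp 2 (EuclideanSpace ℝ (Fin l) × EuclideanSpace ℝ (Fin k)) →
      EuclideanSpace ℝ (Fin k))
    (hg : ContDiff ℝ 1 g)
    (p : WithLp 2 (EuclideanSpace ℝ (Fin l) × EuclideanSpace ℝ (Fin k)))
    (hp : g p ∈ D)
    (hrank : Module.finrank ℝ (LinearMap.range (fderiv ℝ g p).toLinearMap) = k)
    (Q : WithLp 2 (EuclideanSpace ℝ (Fin l) × EuclideanSpace ℝ (Fin k)) →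
      Set (EuclideanSpace ℝ (Fin k)))
    (hQ : ∀ q, Q q = VarAnal.normalCone D (g q))
    (ds : EuclideanSpace ℝ (Fin k)) (hds : ds ∈ VarAnal.normalCone D (g p)) :
    VarAnal.HasSCDPropertyAround Q (WithLp.toLp 2 (p, ds)) ∧
    VarAnal.SemismoothStarAround Q (WithLp.toLp 2 (p, ds)) ∧
    -- the elements of `𝒮Q`, as sets, are exactly the sets given by the faces
    SetLike.coe ''
        VarAnal.scDerivative Q (WithLp.toLp 2 (p, ds)) =
      {S | ∃ F, VarAnal.IsFace (VarAnal.criticalCone D (g p) ds) F ∧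
        S = {w : WithLp 2 (WithLp 2 (EuclideanSpace ℝ (Fin l) × EuclideanSpace ℝ (Fin k)) ×
            EuclideanSpace ℝ (Fin k)) |
          fderiv ℝ g p w.fst ∈ F - F ∧ w.snd ∈ VarAnal.orth (F - F)}} ∧
    VarAnal.outerLimitingTangentCone (VarAnal.gph Q) (WithLp.toLp 2 (p, ds)) =
      {w | ∃ F₁ F₂, VarAnal.IsFace (VarAnal.criticalCone D (g p) ds) F₁ ∧
        VarAnal.IsFace (VarAnal.criticalCone D (g p) ds) F₂ ∧ F₂ ⊆ F₁ ∧
        WithLp.toLp 2 (fderiv ℝ g p w.fst, w.snd) ∈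
          VarAnal.gph (VarAnal.normalCone (F₁ - F₂))} := by
  obtain rfl : Q = fun q => VarAnal.normalCone D (g q) := funext hQ
  have hsurj : Function.Surjective (fderiv ℝ g p) :=
    LinearMap.range_eq_top.1 (Submodule.eq_top_of_finrank_eq (by simpa using hrank))
  have hK := hD.isPolyhedralCone_criticalCone (ds := ds) hds.1
  have hev := VarAnal.eventually_surjective_fderiv_fst (ds := ds) hg hsurj
  refine ⟨⟨_, hev, fun z hz => VarAnal.hasSCDPropertyAt_comp hD hg hz.2 hz.1⟩,
    ⟨_, hev, fun z hz => VarAnal.semismoothStarAt_comp hD hg hz.2 hz.1⟩, ?_,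
    VarAnal.outerLimitingTangentCone_gph_comp hD hg hsurj hds⟩
  have hset : ∀ F, VarAnal.IsFace (VarAnal.criticalCone D (g p) ds) F →
      (((VarAnal.normalGraph (Submodule.span ℝ F)).comap
        (fderiv ℝ (VarAnal.graphMap g) (WithLp.toLp 2 (p, ds))).toLinearMap :
          Submodule ℝ _) : Set _) =
        {w : WithLp 2 (WithLp 2 (EuclideanSpace ℝ (Fin l) × EuclideanSpace ℝ (Fin k)) ×
            EuclideanSpace ℝ (Fin k)) |
          fderiv ℝ g p w.fst ∈ F - F ∧ w.snd ∈ VarAnal.orth (F - F)} := by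
    intro F hF
    ext w
    rw [hK.sub_self_eq_span hF, VarAnal.orth_submodule]
    change fderiv ℝ (VarAnal.graphMap g) (WithLp.toLp 2 (p, ds)) w ∈
      VarAnal.normalGraph (Submodule.span ℝ F) ↔ _
    rw [VarAnal.fderiv_graphMap_apply hg]
    rfl
  ext S
  constructor
  · rintro ⟨L, hL, rfl⟩
    obtain ⟨F, hF, rfl⟩ := (VarAnal.mem_scDerivative_iff hD hg hsurj hds).1 hL
    exact ⟨F, hF, hset F hF⟩
  · rintro ⟨F, hF, rfl⟩
    exact ⟨_, (VarAnal.mem_scDerivative_iff hD hg hsurj hds).2 ⟨F, hF, rfl⟩, hset F hF⟩
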